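/- Let $\mathbb{H}$ be a real separable Hilbert space and let $(x_t)_{t\in\mathbb{Z}}$ be an $\mathbb{H}$-valued centered (strictly) stationary Gaussian process. For $h\in\mathbb{Z}$ let $\Sigma_h$ be the cross-covariance operator $\Sigma_h u:=\mathbb{E}[\langle x_{t+h},u\rangle x_t]$, $u\in\mathbb{H}$ (independent of $t$ by stationarity), and suppose that $\Sigma_h$ is of trace class for all $h\in\mathbb{Z}$. Let $n\ge 1$ and, for $u\in\mathbb{H}$, set $$\hat\Sigma_0u:=\frac1n\sum_{t=1}^{n}\langle x_t,u\rangle x_t,\qquad \bar\Sigma_nu:=\Sigma_0u+2\sum_{h=1}^{n-1}\tilde\Sigma_hu,\qquad \tilde\Sigma_hu:=\frac12\sum_i\sigma_{h,i}\bigl(\langle f_{h,i},u\rangle f_{h,i}+\langle g_{h,i},u\rangle g_{h,i}\bigr),$$ where, for each $1\le h\le n-1$, $\Sigma_hu=\sum_i\sigma_{h,i}\langle g_{h,i},u\rangle f_{h,i}$ is any singular value decomposition of $\Sigma_h$, with singular values $\sigma_{h,i}\ge0$, orthonormal left singular vectors $f_{h,i}$ and orthonormal right singular vectors $g_{h,i}$.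 Then $\|\hat\Sigma_0-\Sigma_0\|$ is integrable, the traces of $\Sigma_0$ and $\bar\Sigma_n$ are finite, and $$\mathbb{E}\bigl[\|\hat\Sigma_0-\Sigma_0\|\bigr]\le\frac{2\sqrt2}{n}\Bigl(\sqrt2\,\mathrm{tr}(\bar\Sigma_n)+\sqrt{2n\|\Sigma_0\|\,\mathrm{tr}(\bar\Sigma_n)}+\sqrt{n\,\mathrm{tr}(\Sigma_0)\,\|\bar\Sigma_n\|}\Bigr).$$ Here $\|\cdot\|$ is the operator norm, and $\mathrm{tr}(T)=\sum_i\langle e_i,Te_i\rangle$ for any orthonormal (Hilbert) basis $(e_i)$ of $\mathbb{H}$. -/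

import Mathlib

open MeasureTheory ProbabilityTheory
open scoped RealInnerProductSpace

noncomputable section

namespace DependentCovariance

variable {H : Type*} [NormedAddCommGroup H] [InnerProductSpace ℝ H]
variable {Ω : Type*} [MeasurableSpace Ω]

/-- Strict stationarity of a process indexed by the integers: the finite-dimensional distributions
are invariant under time shifts. -/
def IsStationary [MeasurableSpace H] (P : Measure Ω) (x : ℤ → Ω → H) : Prop :=
  ∀ (h : ℤ) (I : Finset ℤ),
    P.map (fun ω (t : I) => x ((t : ℤ) + h) ω) = P.map (fun ω (t : I) => x (t : ℤ) ω)

/-- The lag-`h` cross-covariance operator `u ↦ E[⟪x (t + h), u⟫ • x t]`, written as the Bochner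
expectation of the rank-one operators `u ↦ ⟪x (t + h), u⟫ • x t`. For a stationary process it does
not depend on `t`, so it is taken at `t = 0`. -/
def crossCov (P : Measure Ω) (x : ℤ → Ω → H) (h : ℤ) : H →L[ℝ] H :=
  ∫ ω, InnerProductSpace.rankOne ℝ (x 0 ω) (x h ω) ∂P

/-- The empirical covariance operator `u ↦ (1 / n) ∑_{t = 1}^n ⟪x t, u⟫ • x t`. -/
def empCov (x : ℤ → Ω → H) (n : ℕ) (ω : Ω) : H →L[ℝ] H :=
  (1 / (n : ℝ)) • ∑ t ∈ Finset.Icc (1 : ℤ) n, InnerProductSpace.rankOne ℝ (x t ω) (x t ω)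

/-- `(σ, f, g)` is a singular value decomposition of `T`: the singular values `σ i` are
non-negative, the left singular vectors `f i` are orthonormal, the right singular vectors `g i` are
orthonormal, and `T u = ∑ i, σ i ⟪g i, u⟫ f i` for all `u`. -/
structure IsSVD {ι : Type*} (T : H →L[ℝ] H) (σ : ι → ℝ) (f g : ι → H) : Prop where
  nonneg : ∀ i, 0 ≤ σ i
  left_orthonormal : Orthonormal ℝ f
  right_orthonormal : Orthonormal ℝ g
  hasSum : ∀ u, HasSum (fun i => (σ i * ⟪g i, u⟫) • f i) (T u)

/-- Trace class operators: those that have an at most countable singular value decomposition with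
summable singular values. (A set of natural numbers as index set covers the case of finite rank.) -/
def IsTraceClass (T : H →L[ℝ] H) : Prop :=
  ∃ (s : Set ℕ) (σ : s → ℝ) (f g : s → H), IsSVD T σ f g ∧ Summable σ

/-- The operator `u ↦ (1 / 2) ∑ i, σ i (⟪f i, u⟫ f i + ⟪g i, u⟫ g i)`; the series converges
absolutely in operator norm when the singular values are summable. -/
def tildeCov {ι : Type*} (σ : ι → ℝ) (f g : ι → H) : H →L[ℝ] H :=
  (1 / 2 : ℝ) • ∑' i, σ i •
    (InnerProductSpace.rankOne ℝ (f i) (f i) + InnerProductSpace.rankOne ℝ (g i) (g i))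

/-- The integrated covariance operator `Σ₀ + 2 ∑_{h = 1}^{n - 1} Σ̃_h`, where `Σ̃_h` is built from
a singular value decomposition `(σ h, f h, g h)` of the lag-`h` cross-covariance operator. -/
def integratedCov (P : Measure Ω) (x : ℤ → Ω → H) {ι : ℕ → Type*}
    (σ : ∀ h, ι h → ℝ) (f g : ∀ h, ι h → H) (n : ℕ) : H →L[ℝ] H :=
  crossCov P x 0 + (2 : ℝ) • ∑ h ∈ Finset.Ico 1 n, tildeCov (σ h) (f h) (g h)

/-- The trace of `T`, computed along the Hilbert basis `b`. -/
def trace {κ : Type*} (b : HilbertBasis κ ℝ H) (T : H →L[ℝ] H) : ℝ :=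
  ∑' i, ⟪b i, T (b i)⟫

end DependentCovariance

end

/-!
Write `A` for the mean of `‖gram x - n • Σ₀‖`, where `gram x = ∑ t, x t ⊗ x t` is `n` times the
empirical covariance operator, `Γ` for the integrated covariance operator and `T` for its trace.

Subtracting an independent copy of the sample and rotating the pair of Gaussian vectors by `π / 4`
gives `A ≤ E ‖crossGram x x'‖` with `crossGram x x' = ∑ t, (x t ⊗ x' t + x' t ⊗ x t)`
(`integral_norm_gram_sub_le`). Conditionally on `x'`, the quadratic form of this operator is a
linear image of the Gaussian vector `(x 1, …, x n)`. The dependence between the `x t` is removed by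
`integral_sum_inner_sq_le`: for a singular value decomposition of the lag-`h` covariance one has
`2 ⟪u, Σ_h v⟫ ≤ ⟪u, |Σ_h*| u⟫ + ⟪v, |Σ_h| v⟫`, so the covariance operator of the vector is dominated
by the block-diagonal operator with all blocks equal to `Γ`.

The dominating Gaussian process is bilinear, and the Sudakov–Fernique inequality
(`sudakov_fernique`) compares it with a decoupled sum, as in Chevet's inequality. Because the same
unit vector enters both factors, the two contributions combine in quadrature, with
`R ^ 2 = ‖gram x'‖` (`integral_sup'_le_of_increments_le`). Integrating over `x'` yields
`A ≤ 2 √(Y T + ‖Γ‖ Q + 2 ‖Γ‖ √Y √Q)`, where `Y = E ‖gram x‖` and `Q = n tr Σ₀`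
(`integral_norm_crossGram_le`). Since `Y ≤ n ‖Σ₀‖ + A`, this bounds `A` in terms of itself; together
with `‖Γ‖ ≤ T` and `‖Γ‖ ≤ 2 n ‖Σ₀‖` it can be solved for `A` with the stated constants
(`le_of_le_two_mul_sqrt`).

The Sudakov–Fernique inequality is obtained by Gaussian interpolation of the soft maximum, from an
integration by parts formula for Gaussian measures on Banach spaces, which is the infinitesimal form
of the rotation invariance of `μ.prod μ`.
-/

namespace DependentCovariance

set_option linter.unusedSectionVars false

/-! ### Gaussian integration by parts -/

section IntegrationByParts

variable {E : Type*} [NormedAddCommGroup E] [NormedSpace ℝ E] [CompleteSpace E]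
  [SecondCountableTopology E] [MeasurableSpace E] [BorelSpace E]

/-- Gaussian integration by parts for a centered Gaussian measure on a Banach space. It is the
derivative at angle `0` of the invariance of `μ.prod μ` under rotations, tested on the function
`(x, y) ↦ ℓ y * h x`. -/
theorem integral_mul_eq_integral_fderiv {μ : Measure E} [IsGaussian μ] (hμ : μ[id] = 0)
    (ℓ : StrongDual ℝ E) {h : E → ℝ} {h' : E → StrongDual ℝ E} {C : ℝ}
    (hd : ∀ x, HasFDerivAt h (h' x) x) (hc' : Continuous h') (hC : ∀ x, |h x| ≤ C)
    (hC' : ∀ x, ‖h' x‖ ≤ C) :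
    ∫ x, ℓ x * h x ∂μ = ∫ p, ℓ p.2 * h' p.1 p.2 ∂(μ.prod μ) := by
  have hc : Continuous h := continuous_iff_continuousAt.2 fun x => (hd x).continuousAt
  have hC0 : 0 ≤ C := (abs_nonneg _).trans (hC 0)
  have m1 : MemLp (fun x : E => x) 2 μ := IsGaussian.memLp_two_id
  have i1 : Integrable (fun p : E × E => ‖p.1‖) (μ.prod μ) :=
    (IsGaussian.integrable_id (μ := μ)).norm.comp_fst μ
  have i2 : Integrable (fun p : E × E => ‖p.2‖) (μ.prod μ) :=
    (IsGaussian.integrable_id (μ := μ)).norm.comp_snd μ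
  have s1 : Integrable (fun p : E × E => ‖p.1‖ ^ 2) (μ.prod μ) := m1.norm.integrable_sq.comp_fst μ
  have s2 : Integrable (fun p : E × E => ‖p.2‖ ^ 2) (μ.prod μ) := m1.norm.integrable_sq.comp_snd μ
  let U : ℝ → E × E → E := fun θ p => Real.cos θ • p.1 + Real.sin θ • p.2
  let V : ℝ → E × E → E := fun θ p => -Real.sin θ • p.1 + Real.cos θ • p.2
  have hU : ∀ θ p, HasDerivAt (fun θ => U θ p) (V θ p) θ := fun θ p =>
    ((Real.hasDerivAt_cos θ).smul_const p.1).add ((Real.hasDerivAt_sin θ).smul_const p.2)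
  have hV : ∀ θ p, HasDerivAt (fun θ => V θ p) (-U θ p) θ := fun θ p => by
    have := ((Real.hasDerivAt_sin θ).neg.smul_const p.1).add
      ((Real.hasDerivAt_cos θ).smul_const p.2)
    have e : -U θ p = -Real.cos θ • p.1 + -Real.sin θ • p.2 := by simp only [U]; module
    rw [e]
    exact this
  have nU : ∀ θ p, ‖U θ p‖ ≤ ‖p.1‖ + ‖p.2‖ := fun θ p => by
    refine (norm_add_le _ _).trans ?_
    rw [norm_smul, norm_smul]
    gcongr
    · exact mul_le_of_le_one_left (norm_nonneg _) (Real.abs_cos_le_one θ)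
    · exact mul_le_of_le_one_left (norm_nonneg _) (Real.abs_sin_le_one θ)
  have nV : ∀ θ p, ‖V θ p‖ ≤ ‖p.1‖ + ‖p.2‖ := fun θ p => by
    refine (norm_add_le _ _).trans ?_
    rw [norm_smul, norm_smul, norm_neg]
    gcongr
    · exact mul_le_of_le_one_left (norm_nonneg _) (Real.abs_sin_le_one θ)
    · exact mul_le_of_le_one_left (norm_nonneg _) (Real.abs_cos_le_one θ)
  have cU : ∀ θ, Continuous (U θ) := fun θ => by fun_prop
  have cV : ∀ θ, Continuous (V θ) := fun θ => by fun_prop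
  have key := hasDerivAt_integral_of_dominated_loc_of_deriv_le (μ := μ.prod μ)
    (F := fun θ p => ℓ (V θ p) * h (U θ p))
    (F' := fun θ p => ℓ (-U θ p) * h (U θ p) + ℓ (V θ p) * h' (U θ p) (V θ p))
    (x₀ := (0 : ℝ)) (s := Set.univ)
    (bound := fun p => ‖ℓ‖ * (‖p.1‖ + ‖p.2‖) * C
      + 2 * ‖ℓ‖ * C * ‖p.1‖ ^ 2 + 2 * ‖ℓ‖ * C * ‖p.2‖ ^ 2) Filter.univ_mem
    (.of_forall fun θ => Continuous.aestronglyMeasurable (by fun_prop))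
    (by
      refine Integrable.mono' (((i1.add i2).const_mul ‖ℓ‖).mul_const C)
        (Continuous.aestronglyMeasurable (by fun_prop)) (.of_forall fun p => ?_)
      change _ ≤ ‖ℓ‖ * (‖p.1‖ + ‖p.2‖) * C
      rw [norm_mul]
      exact mul_le_mul ((ℓ.le_opNorm _).trans (by gcongr; exact nV 0 p)) (hC _) (norm_nonneg _)
        (by positivity))
    (Continuous.aestronglyMeasurable (by
      have : Continuous fun p : E × E => h' (U 0 p) (V 0 p) :=
        (hc'.comp (cU 0)).clm_apply (cV 0)
      fun_prop))
    (.of_forall fun p θ _ => by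
      refine (norm_add_le _ _).trans ?_
      rw [norm_mul, norm_mul, add_assoc]
      refine add_le_add ?_ ?_
      · exact mul_le_mul ((ℓ.le_opNorm _).trans (by rw [norm_neg]; gcongr; exact nU θ p)) (hC _)
          (norm_nonneg _) (by positivity)
      · have h1 : ‖ℓ (V θ p)‖ ≤ ‖ℓ‖ * (‖p.1‖ + ‖p.2‖) :=
          (ℓ.le_opNorm _).trans (by gcongr; exact nV θ p)
        have h2 : ‖h' (U θ p) (V θ p)‖ ≤ C * (‖p.1‖ + ‖p.2‖) :=
          (ContinuousLinearMap.le_opNorm _ _).trans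
            (mul_le_mul (hC' _) (nV θ p) (norm_nonneg _) hC0)
        refine (mul_le_mul h1 h2 (norm_nonneg _) (by positivity)).trans ?_
        have : 0 ≤ ‖ℓ‖ * C * (‖p.1‖ - ‖p.2‖) ^ 2 := by positivity
        nlinarith)
    (by
      refine ((((i1.add i2).const_mul ‖ℓ‖).mul_const C).add (s1.const_mul _)).add (s2.const_mul _))
    (.of_forall fun p θ _ =>
      (ℓ.hasFDerivAt.comp_hasDerivAt θ (hV θ p)).mul ((hd _).comp_hasDerivAt θ (hU θ p)))
  -- by rotation invariance the differentiated integral does not depend on the angle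
  have hconst : ∀ θ, ∫ p, ℓ (V θ p) * h (U θ p) ∂(μ.prod μ) = ∫ p, ℓ p.2 * h p.1 ∂(μ.prod μ) := by
    intro θ
    conv_rhs => rw [← IsGaussian.map_rotation_eq_self hμ θ]
    rw [integral_map (by fun_prop) (Continuous.aestronglyMeasurable (by fun_prop))]
    rfl
  have hz : ∫ p, ℓ (-U 0 p) * h (U 0 p) + ℓ (V 0 p) * h' (U 0 p) (V 0 p) ∂(μ.prod μ) = 0 := by
    have := key.2
    simp_rw [hconst] at this
    exact this.unique (hasDerivAt_const _ _)
  have e : ∀ p : E × E, ℓ (-U 0 p) * h (U 0 p) + ℓ (V 0 p) * h' (U 0 p) (V 0 p)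
      = ℓ p.2 * h' p.1 p.2 - ℓ p.1 * h p.1 := fun p => by simp [U, V]; ring
  simp_rw [e] at hz
  have j1 : Integrable (fun p : E × E => ℓ p.1 * h p.1) (μ.prod μ) := by
    refine Integrable.mono' ((i1.const_mul ‖ℓ‖).mul_const C)
      (Continuous.aestronglyMeasurable (by fun_prop)) (.of_forall fun p => ?_)
    rw [norm_mul]
    exact mul_le_mul (ℓ.le_opNorm _) (hC _) (norm_nonneg _) (by positivity)
  have j2 : Integrable (fun p : E × E => ℓ p.2 * h' p.1 p.2) (μ.prod μ) := by
    refine Integrable.mono' (s2.const_mul (‖ℓ‖ * C))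
      (Continuous.aestronglyMeasurable ?_) (.of_forall fun p => ?_)
    · exact (ℓ.continuous.comp continuous_snd).mul
        ((hc'.comp continuous_fst).clm_apply continuous_snd)
    · rw [norm_mul]
      refine (mul_le_mul (ℓ.le_opNorm _) ((ContinuousLinearMap.le_opNorm _ _).trans
        (mul_le_mul_of_nonneg_right (hC' _) (norm_nonneg _))) (norm_nonneg _)
        (by positivity)).trans (le_of_eq (by ring))
  rw [integral_sub j2 j1, sub_eq_zero] at hz
  rw [hz, integral_fun_fst (fun x => ℓ x * h x)]
  simp

end IntegrationByParts

/-! ### The Sudakov–Fernique inequality -/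

section SoftMax

variable {ι : Type*} [Fintype ι]

/-- The smooth approximation `log (∑ i, exp (v i))` of the maximum. -/
noncomputable def logSumExp (v : ι → ℝ) : ℝ := Real.log (∑ i, Real.exp (v i))

/-- The partial derivatives of `logSumExp`: the Gibbs weights of the vector `v`. -/
noncomputable def softmax (v : ι → ℝ) (i : ι) : ℝ := Real.exp (v i) / ∑ j, Real.exp (v j)

variable [Nonempty ι]

lemma sum_exp_pos (v : ι → ℝ) : 0 < ∑ i, Real.exp (v i) :=
  Finset.sum_pos (fun _ _ => Real.exp_pos _) Finset.univ_nonempty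

lemma softmax_nonneg (v : ι → ℝ) (i : ι) : 0 ≤ softmax v i :=
  div_nonneg (Real.exp_pos _).le (sum_exp_pos v).le

lemma softmax_le_one (v : ι → ℝ) (i : ι) : softmax v i ≤ 1 :=
  (div_le_one (sum_exp_pos v)).2
    (Finset.single_le_sum (f := fun j => Real.exp (v j)) (fun _ _ => (Real.exp_pos _).le)
      (Finset.mem_univ i))

lemma sum_softmax (v : ι → ℝ) : ∑ i, softmax v i = 1 := by
  simp only [softmax]
  rw [← Finset.sum_div, div_self (sum_exp_pos v).ne']

lemma continuous_softmax (i : ι) : Continuous fun v : ι → ℝ => softmax v i :=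
  Continuous.div (by fun_prop) (by fun_prop) fun v => (sum_exp_pos v).ne'

lemma continuous_logSumExp : Continuous (logSumExp : (ι → ℝ) → ℝ) :=
  Continuous.log (by fun_prop) fun v => (sum_exp_pos v).ne'

lemma sup'_le_logSumExp (v : ι → ℝ) :
    Finset.univ.sup' Finset.univ_nonempty v ≤ logSumExp v := by
  refine Finset.sup'_le _ _ fun i _ => ?_
  rw [logSumExp, Real.le_log_iff_exp_le (sum_exp_pos v)]
  exact Finset.single_le_sum (f := fun j => Real.exp (v j)) (fun _ _ => (Real.exp_pos _).le)
    (Finset.mem_univ i)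

lemma logSumExp_le (v : ι → ℝ) :
    logSumExp v ≤ Finset.univ.sup' Finset.univ_nonempty v + Real.log (Fintype.card ι) := by
  have hcard : (0 : ℝ) < Fintype.card ι := by exact_mod_cast Fintype.card_pos
  rw [logSumExp, Real.log_le_iff_le_exp (sum_exp_pos v), Real.exp_add, Real.exp_log hcard, mul_comm]
  calc ∑ i, Real.exp (v i)
      ≤ ∑ _i : ι, Real.exp (Finset.univ.sup' Finset.univ_nonempty v) :=
        Finset.sum_le_sum fun i _ => Real.exp_le_exp.2 (Finset.le_sup' v (Finset.mem_univ i))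
    _ = _ := by simp

lemma abs_sup'_le (v : ι → ℝ) :
    |Finset.univ.sup' Finset.univ_nonempty v| ≤ ∑ i, |v i| := by
  obtain ⟨i, -, hi⟩ := Finset.exists_mem_eq_sup' Finset.univ_nonempty v
  rw [hi]
  exact Finset.single_le_sum (f := fun j => |v j|) (fun _ _ => abs_nonneg _) (Finset.mem_univ i)

lemma abs_logSumExp_le (v : ι → ℝ) :
    |logSumExp v| ≤ ∑ i, |v i| + Real.log (Fintype.card ι) := by
  have h1 := sup'_le_logSumExp v
  have h2 := logSumExp_le v
  have h3 := abs_le.1 (abs_sup'_le v)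
  have h4 : 0 ≤ Real.log (Fintype.card ι) := Real.log_natCast_nonneg _
  exact abs_le.2 ⟨by linarith [h3.1], by linarith [h3.2]⟩

lemma hasDerivAt_logSumExp {v : ℝ → ι → ℝ} {v' : ι → ℝ} {t : ℝ}
    (hv : ∀ i, HasDerivAt (fun t => v t i) (v' i) t) :
    HasDerivAt (fun t => logSumExp (v t)) (∑ i, softmax (v t) i * v' i) t := by
  have h := (HasDerivAt.fun_sum (u := Finset.univ) fun i _ => (hv i).exp).log (sum_exp_pos (v t)).ne'
  refine h.congr_deriv ?_
  rw [Finset.sum_div]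
  exact Finset.sum_congr rfl fun i _ => by rw [softmax]; ring

lemma hasFDerivAt_softmax {E : Type*} [NormedAddCommGroup E] [NormedSpace ℝ E]
    (ζ : ι → StrongDual ℝ E) (i : ι) (z : E) :
    HasFDerivAt (fun z => softmax (fun j => ζ j z) i)
      (softmax (fun j => ζ j z) i • (ζ i - ∑ j, softmax (fun j => ζ j z) j • ζ j)) z := by
  have hS : HasFDerivAt (fun z => ∑ j, Real.exp (ζ j z)) (∑ j, Real.exp (ζ j z) • ζ j) z :=
    HasFDerivAt.fun_sum fun j _ => (ζ j).hasFDerivAt.exp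
  have hpos := (sum_exp_pos fun j => ζ j z).ne'
  have h := (ζ i).hasFDerivAt.exp.mul ((hasDerivAt_inv hpos).comp_hasFDerivAt z hS)
  refine h.congr_fderiv ?_
  ext w
  change Real.exp (ζ i z) * (-((∑ i, Real.exp (ζ i z)) ^ 2)⁻¹ *
      (∑ j, Real.exp (ζ j z) • ζ j) w) + (∑ j, Real.exp (ζ j z))⁻¹ * (Real.exp (ζ i z) * ζ i w) = _
  simp only [softmax, smul_apply,
    sub_apply, sum_apply, smul_eq_mul]
  have : ∑ x, Real.exp (ζ x z) / (∑ j, Real.exp (ζ j z)) * ζ x w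
      = (∑ x, Real.exp (ζ x z) * ζ x w) / ∑ j, Real.exp (ζ j z) := by
    rw [Finset.sum_div]; exact Finset.sum_congr rfl fun x _ => by ring
  rw [this]
  field_simp
  ring

end SoftMax

section Integrability

variable {ι : Type*} [Fintype ι] [Nonempty ι]
  {E : Type*} [NormedAddCommGroup E] [NormedSpace ℝ E] [MeasurableSpace E] [BorelSpace E]

lemma continuous_sup' : Continuous fun v : ι → ℝ => Finset.univ.sup' Finset.univ_nonempty v :=
  Continuous.finset_sup'_apply _ fun i _ => continuous_apply i

lemma integrable_sup' (μ : Measure E) [IsGaussian μ] (L : ι → StrongDual ℝ E) :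
    Integrable (fun x => Finset.univ.sup' Finset.univ_nonempty (fun i => L i x)) μ :=
  Integrable.mono' (integrable_finsetSum Finset.univ fun i _ =>
      (IsGaussian.integrable_dual μ (L i)).abs)
    (continuous_sup'.comp (continuous_pi fun j => (L j).continuous)).aestronglyMeasurable
    (.of_forall fun _ => abs_sup'_le _)

lemma integrable_logSumExp (μ : Measure E) [IsGaussian μ] (L : ι → StrongDual ℝ E) :
    Integrable (fun x => logSumExp (fun i => L i x)) μ :=
  Integrable.mono' ((integrable_finsetSum Finset.univ fun i _ =>
      (IsGaussian.integrable_dual μ (L i)).abs).add (integrable_const _))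
    (continuous_logSumExp.comp (continuous_pi fun j => (L j).continuous)).aestronglyMeasurable
    (.of_forall fun _ => abs_logSumExp_le _)

end Integrability

section SudakovFernique

variable {E : Type*} [NormedAddCommGroup E] [NormedSpace ℝ E] [CompleteSpace E]
  [SecondCountableTopology E] [MeasurableSpace E] [BorelSpace E]
  {F : Type*} [NormedAddCommGroup F] [NormedSpace ℝ F] [CompleteSpace F]
  [SecondCountableTopology F] [MeasurableSpace F] [BorelSpace F]
  {ι : Type*} [Fintype ι] [Nonempty ι]

lemma integral_id_prod_eq_zero {μ : Measure E} [IsGaussian μ] {ν : Measure F} [IsGaussian ν]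
    (hμ : μ[id] = 0) (hν : ν[id] = 0) : (μ.prod ν)[id] = 0 := by
  have hi : Integrable (id : E × F → E × F) (μ.prod ν) := IsGaussian.integrable_id
  refine Prod.ext ?_ ?_
  · have := (ContinuousLinearMap.fst ℝ E F).integral_comp_comm hi
    simp only [ContinuousLinearMap.coe_fst', id] at this
    rw [integral_fun_fst (fun x : E => x)] at this
    simpa using this.symm.trans (by simpa using hμ)
  · have := (ContinuousLinearMap.snd ℝ E F).integral_comp_comm hi
    simp only [ContinuousLinearMap.coe_snd', id] at this
    rw [integral_fun_snd (fun x : F => x)] at this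
    simpa using this.symm.trans (by simpa using hν)

/-- The mean of a softmax-weighted sum of Gaussian variables `ζ' i`, with weights given by
jointly Gaussian variables `ζ i`, in terms of the covariances of the increments. -/
lemma integral_sum_softmax_mul {μ : Measure E} [IsGaussian μ] (hμ : μ[id] = 0)
    (ζ ζ' : ι → StrongDual ℝ E) :
    ∫ z, ∑ i, softmax (fun j => ζ j z) i * ζ' i z ∂μ =
      ∑ i, ∑ j, (∫ z, softmax (fun k => ζ k z) i * softmax (fun k => ζ k z) j ∂μ) *
        ((1 / 2) * ∫ w, (ζ i w - ζ j w) * (ζ' i w - ζ' j w) ∂μ) := by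
  have cp : ∀ i, Continuous fun z => softmax (fun j => ζ j z) i := fun i =>
    (continuous_softmax i).comp (continuous_pi fun j => (ζ j).continuous)
  have m2 : ∀ ℓ : StrongDual ℝ E, MemLp (fun z => ℓ z) 2 μ := fun ℓ =>
    IsGaussian.memLp_dual μ ℓ 2 (by norm_num)
  have hb : ∀ z i, |softmax (fun j => ζ j z) i| ≤ 1 := fun z i => by
    rw [abs_of_nonneg (softmax_nonneg _ _)]; exact softmax_le_one _ _
  let D : ι → E → StrongDual ℝ E := fun i z =>
    softmax (fun j => ζ j z) i • (ζ i - ∑ j, softmax (fun j => ζ j z) j • ζ j)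
  have hD : ∀ i z, ‖D i z‖ ≤ 1 + 2 * ∑ j, ‖ζ j‖ := fun i z => by
    have h1 : ‖ζ i‖ ≤ ∑ j, ‖ζ j‖ :=
      Finset.single_le_sum (f := fun j => ‖ζ j‖) (fun _ _ => norm_nonneg _) (Finset.mem_univ i)
    have h2 : ‖∑ j, softmax (fun j => ζ j z) j • ζ j‖ ≤ ∑ j, ‖ζ j‖ := by
      refine (norm_sum_le _ _).trans (Finset.sum_le_sum fun j _ => ?_)
      rw [norm_smul]
      exact mul_le_of_le_one_left (norm_nonneg _) (hb z j)
    rw [norm_smul]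
    refine (mul_le_of_le_one_left (norm_nonneg _) (hb z i)).trans ((norm_sub_le _ _).trans ?_)
    linarith
  have ibp : ∀ i, ∫ z, ζ' i z * softmax (fun j => ζ j z) i ∂μ
      = ∫ p, ζ' i p.2 * D i p.1 p.2 ∂(μ.prod μ) := fun i =>
    integral_mul_eq_integral_fderiv (C := 1 + 2 * ∑ j, ‖ζ j‖) hμ (ζ' i)
      (fun z => hasFDerivAt_softmax ζ i z)
      ((cp i).smul (continuous_const.sub (continuous_finsetSum _ fun j _ =>
        (cp j).smul continuous_const)))
      (fun z => (hb z i).trans (by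
        have : 0 ≤ ∑ j, ‖ζ j‖ := Finset.sum_nonneg fun _ _ => norm_nonneg _
        linarith)) (hD i)
  have hint : ∀ i, Integrable (fun z => softmax (fun j => ζ j z) i * ζ' i z) μ := fun i =>
    ((m2 (ζ' i)).integrable (by norm_num)).bdd_mul (cp i).aestronglyMeasurable
      (.of_forall fun z => hb z i)
  have ipp : ∀ i j, Integrable
      (fun z => softmax (fun k => ζ k z) i * softmax (fun k => ζ k z) j) μ := fun i j =>
    Integrable.of_bound ((cp i).mul (cp j)).aestronglyMeasurable 1 (.of_forall fun z => by
      rw [norm_mul]; exact mul_le_one₀ (hb z i) (norm_nonneg _) (hb z j))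
  have iw : ∀ i j, Integrable (fun w => (ζ i w - ζ j w) * (ζ' i w - ζ' j w)) μ := fun i j =>
    ((m2 (ζ i)).sub (m2 (ζ j))).integrable_mul ((m2 (ζ' i)).sub (m2 (ζ' j)))
  have iD : ∀ i, Integrable (fun p : E × E => ζ' i p.2 * D i p.1 p.2) (μ.prod μ) := fun i => by
    have e : ∀ p : E × E, ζ' i p.2 * D i p.1 p.2 = softmax (fun j => ζ j p.1) i * (ζ' i p.2 * ζ i p.2)
        - ∑ j, (softmax (fun k => ζ k p.1) i * softmax (fun k => ζ k p.1) j) *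
          (ζ' i p.2 * ζ j p.2) := fun p => by
      simp only [D, smul_apply, sub_apply,
        sum_apply, smul_eq_mul, mul_sub, Finset.mul_sum]
      congr 1
      · ring
      · exact Finset.sum_congr rfl fun j _ => by ring
    simp_rw [e]
    refine Integrable.sub ?_ (integrable_finsetSum _ fun j _ => ?_)
    · exact (Integrable.of_bound (cp i).aestronglyMeasurable 1 (.of_forall fun z => hb z i)).mul_prod
        ((m2 (ζ' i)).integrable_mul (m2 (ζ i)))
    · exact (ipp i j).mul_prod ((m2 (ζ' i)).integrable_mul (m2 (ζ j)))
  -- symmetrize the double sum over the Gibbs weights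
  have alg : ∀ p : E × E, ∑ i, ζ' i p.2 * D i p.1 p.2 =
      ∑ i, ∑ j, (softmax (fun k => ζ k p.1) i * softmax (fun k => ζ k p.1) j) *
        ((1 / 2) * ((ζ i p.2 - ζ j p.2) * (ζ' i p.2 - ζ' j p.2))) := by
    intro p
    set q : ι → ℝ := softmax (fun k => ζ k p.1) with hq
    have hs : ∑ j, q j = 1 := sum_softmax _
    have e1 : ∀ i, ζ' i p.2 * D i p.1 p.2
        = ∑ j, (q i * q j) * (ζ' i p.2 * (ζ i p.2 - ζ j p.2)) := fun i => by
      simp only [D, smul_apply, sub_apply,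
        sum_apply, smul_eq_mul, ← hq]
      calc _ = ζ' i p.2 * (q i * ((∑ j, q j) * ζ i p.2 - ∑ j, q j * ζ j p.2)) := by rw [hs, one_mul]
        _ = _ := by
          rw [Finset.sum_mul, ← Finset.sum_sub_distrib, Finset.mul_sum, Finset.mul_sum]
          exact Finset.sum_congr rfl fun j _ => by ring
    have e2 : ∑ i, ∑ j, (q i * q j) * (ζ' i p.2 * (ζ i p.2 - ζ j p.2))
        = ∑ i, ∑ j, (q i * q j) * (ζ' j p.2 * (ζ j p.2 - ζ i p.2)) := by
      rw [Finset.sum_comm]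
      exact Finset.sum_congr rfl fun i _ => Finset.sum_congr rfl fun j _ => by ring
    simp_rw [e1]
    calc _ = (1 / 2) * (∑ i, ∑ j, (q i * q j) * (ζ' i p.2 * (ζ i p.2 - ζ j p.2))
          + ∑ i, ∑ j, (q i * q j) * (ζ' j p.2 * (ζ j p.2 - ζ i p.2))) := by rw [← e2]; ring
      _ = _ := by
        rw [← Finset.sum_add_distrib, Finset.mul_sum]
        refine Finset.sum_congr rfl fun i _ => ?_
        rw [← Finset.sum_add_distrib, Finset.mul_sum]
        exact Finset.sum_congr rfl fun j _ => by ring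
  calc ∫ z, ∑ i, softmax (fun j => ζ j z) i * ζ' i z ∂μ
      = ∑ i, ∫ p, ζ' i p.2 * D i p.1 p.2 ∂(μ.prod μ) := by
        rw [integral_finsetSum _ fun i _ => hint i]
        refine Finset.sum_congr rfl fun i _ => ?_
        rw [← ibp i]
        simp_rw [mul_comm]
    _ = ∫ p, ∑ i, ∑ j, (softmax (fun k => ζ k p.1) i * softmax (fun k => ζ k p.1) j) *
        ((1 / 2) * ((ζ i p.2 - ζ j p.2) * (ζ' i p.2 - ζ' j p.2))) ∂(μ.prod μ) := by
        rw [← integral_finsetSum _ fun i _ => iD i]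
        exact integral_congr_ae (.of_forall alg)
    _ = _ := by
        have ii : ∀ i j, Integrable (fun p : E × E =>
            (softmax (fun k => ζ k p.1) i * softmax (fun k => ζ k p.1) j) *
            ((1 / 2) * ((ζ i p.2 - ζ j p.2) * (ζ' i p.2 - ζ' j p.2)))) (μ.prod μ) := fun i j =>
          (ipp i j).mul_prod ((iw i j).const_mul _)
        rw [integral_finsetSum _ fun i _ => integrable_finsetSum _ fun j _ => ii i j]
        refine Finset.sum_congr rfl fun i _ => ?_
        rw [integral_finsetSum _ fun j _ => ii i j]
        refine Finset.sum_congr rfl fun j _ => ?_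
        rw [integral_prod_mul (fun z => softmax (fun k => ζ k z) i * softmax (fun k => ζ k z) j)
          (fun w => (1 / 2) * ((ζ i w - ζ j w) * (ζ' i w - ζ' j w))), integral_const_mul]

/-- The smooth form of the Sudakov–Fernique inequality. Along the interpolation
`cos θ • L i + sin θ • M i` between independent copies of the two families, the mean of `logSumExp`
is nondecreasing. -/
theorem integral_logSumExp_le {μ : Measure E} [IsGaussian μ] {ν : Measure F} [IsGaussian ν]
    (hμ : μ[id] = 0) (hν : ν[id] = 0) (L : ι → StrongDual ℝ E) (M : ι → StrongDual ℝ F)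
    (hLM : ∀ i j, ∫ x, (L i x - L j x) ^ 2 ∂μ ≤ ∫ y, (M i y - M j y) ^ 2 ∂ν) :
    ∫ x, logSumExp (fun i => L i x) ∂μ ≤ ∫ y, logSumExp (fun i => M i y) ∂ν := by
  let π := μ.prod ν
  have hπ : π[id] = 0 := integral_id_prod_eq_zero hμ hν
  let L₁ : ι → StrongDual ℝ (E × F) := fun i => (L i).comp (ContinuousLinearMap.fst ℝ E F)
  let M₁ : ι → StrongDual ℝ (E × F) := fun i => (M i).comp (ContinuousLinearMap.snd ℝ E F)
  let ζ : ℝ → ι → StrongDual ℝ (E × F) := fun θ i => Real.cos θ • L₁ i + Real.sin θ • M₁ i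
  let ζ' : ℝ → ι → StrongDual ℝ (E × F) := fun θ i => -Real.sin θ • L₁ i + Real.cos θ • M₁ i
  have hζ : ∀ i z θ, HasDerivAt (fun θ => ζ θ i z) (ζ' θ i z) θ := fun i z θ =>
    ((Real.hasDerivAt_cos θ).mul_const (L₁ i z)).add ((Real.hasDerivAt_sin θ).mul_const (M₁ i z))
  have iL : ∀ i, Integrable (fun z => |L₁ i z|) π := fun i =>
    (IsGaussian.integrable_dual π (L₁ i)).abs
  have iM : ∀ i, Integrable (fun z => |M₁ i z|) π := fun i =>
    (IsGaussian.integrable_dual π (M₁ i)).abs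
  have clse : ∀ θ, Continuous fun z => logSumExp (fun i => ζ θ i z) := fun θ =>
    continuous_logSumExp.comp (by fun_prop)
  have hder : ∀ θ, HasDerivAt (fun θ => ∫ z, logSumExp (fun i => ζ θ i z) ∂π)
      (∫ z, ∑ i, softmax (fun j => ζ θ j z) i * ζ' θ i z ∂π) θ := by
    intro θ
    refine (hasDerivAt_integral_of_dominated_loc_of_deriv_le (μ := π) (s := Set.univ)
      (F := fun θ z => logSumExp (fun i => ζ θ i z))
      (F' := fun θ z => ∑ i, softmax (fun j => ζ θ j z) i * ζ' θ i z)
      (bound := fun z => ∑ i, (|L₁ i z| + |M₁ i z|)) Filter.univ_mem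
      (.of_forall fun θ => (clse θ).aestronglyMeasurable) ?_ ?_ ?_ ?_ ?_).2
    · exact integrable_logSumExp π (ζ θ)
    · refine Continuous.aestronglyMeasurable (continuous_finsetSum _ fun i _ => ?_)
      exact ((continuous_softmax i).comp (continuous_pi fun j => (ζ θ j).continuous)).mul
        (ζ' θ i).continuous
    · refine .of_forall fun z t _ => (norm_sum_le _ _).trans (Finset.sum_le_sum fun i _ => ?_)
      rw [norm_mul]
      have h1 : ‖softmax (fun j => ζ t j z) i‖ ≤ 1 := by
        rw [Real.norm_of_nonneg (softmax_nonneg _ _)]; exact softmax_le_one _ _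
      refine (mul_le_of_le_one_left (norm_nonneg _) h1).trans ((abs_add_le _ _).trans ?_)
      change |-Real.sin t * L₁ i z| + |Real.cos t * M₁ i z| ≤ _
      rw [abs_mul, abs_mul, abs_neg]
      exact add_le_add (mul_le_of_le_one_left (abs_nonneg _) (Real.abs_sin_le_one t))
        (mul_le_of_le_one_left (abs_nonneg _) (Real.abs_cos_le_one t))
    · exact integrable_finsetSum _ fun i _ => (iL i).add (iM i)
    · exact .of_forall fun z t _ => hasDerivAt_logSumExp fun i => hζ i z t
  have hcov : ∀ θ i j, ∫ w, (ζ θ i w - ζ θ j w) * (ζ' θ i w - ζ' θ j w) ∂π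
      = Real.cos θ * Real.sin θ *
        (∫ y, (M i y - M j y) ^ 2 ∂ν - ∫ x, (L i x - L j x) ^ 2 ∂μ) := by
    intro θ i j
    have mL : MemLp (fun x => L i x - L j x) 2 μ :=
      (IsGaussian.memLp_dual μ (L i) 2 (by norm_num)).sub
        (IsGaussian.memLp_dual μ (L j) 2 (by norm_num))
    have mM : MemLp (fun x => M i x - M j x) 2 ν :=
      (IsGaussian.memLp_dual ν (M i) 2 (by norm_num)).sub
        (IsGaussian.memLp_dual ν (M j) 2 (by norm_num))
    have zL : ∫ x, (L i x - L j x) ∂μ = 0 := by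
      have h := IsGaussian.integral_dual (μ := μ) (L i - L j)
      simp only [id] at hμ
      rw [hμ, map_zero] at h
      exact h
    have e : ∀ w : E × F, (ζ θ i w - ζ θ j w) * (ζ' θ i w - ζ' θ j w)
        = Real.cos θ * Real.sin θ * ((M i w.2 - M j w.2) ^ 2)
          - Real.cos θ * Real.sin θ * ((L i w.1 - L j w.1) ^ 2)
          + (Real.cos θ ^ 2 - Real.sin θ ^ 2) * ((L i w.1 - L j w.1) * (M i w.2 - M j w.2)) := by
      intro w
      simp only [ζ, ζ', L₁, M₁, add_apply, smul_apply,
        ContinuousLinearMap.comp_apply, ContinuousLinearMap.coe_fst', ContinuousLinearMap.coe_snd',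
        smul_eq_mul]
      ring
    simp_rw [e]
    have i1 : Integrable (fun w : E × F => Real.cos θ * Real.sin θ * ((M i w.2 - M j w.2) ^ 2)) π :=
      (mM.integrable_sq.comp_snd μ).const_mul _
    have i2 : Integrable (fun w : E × F => Real.cos θ * Real.sin θ * ((L i w.1 - L j w.1) ^ 2)) π :=
      (mL.integrable_sq.comp_fst ν).const_mul _
    have i3 : Integrable (fun w : E × F => (Real.cos θ ^ 2 - Real.sin θ ^ 2) *
        ((L i w.1 - L j w.1) * (M i w.2 - M j w.2))) π :=
      ((mL.integrable (by norm_num)).mul_prod (mM.integrable (by norm_num))).const_mul _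
    rw [integral_add (by exact i1.sub i2) i3, integral_sub i1 i2, integral_const_mul,
      integral_const_mul, integral_const_mul, integral_prod_mul (fun x => L i x - L j x) (fun y => M i y - M j y), zL,
      integral_fun_fst (fun x => (L i x - L j x) ^ 2), integral_fun_snd (fun y => (M i y - M j y) ^ 2)]
    simp
    ring
  have hmono : MonotoneOn (fun θ => ∫ z, logSumExp (fun i => ζ θ i z) ∂π)
      (Set.Icc 0 (Real.pi / 2)) := by
    refine monotoneOn_of_deriv_nonneg (convex_Icc _ _)
      (fun θ _ => (hder θ).continuousAt.continuousWithinAt)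
      (fun θ _ => (hder θ).differentiableAt.differentiableWithinAt) fun θ hθ => ?_
    rw [interior_Icc] at hθ
    rw [(hder θ).deriv, integral_sum_softmax_mul hπ]
    refine Finset.sum_nonneg fun i _ => Finset.sum_nonneg fun j _ => mul_nonneg ?_ ?_
    · exact integral_nonneg fun z => mul_nonneg (softmax_nonneg _ _) (softmax_nonneg _ _)
    · rw [hcov]
      have hc : 0 ≤ Real.cos θ := Real.cos_nonneg_of_mem_Icc ⟨by linarith [hθ.1, Real.pi_pos], hθ.2.le⟩
      have hs : 0 ≤ Real.sin θ := Real.sin_nonneg_of_nonneg_of_le_pi hθ.1.le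
        (by linarith [hθ.2, Real.pi_pos])
      have := sub_nonneg.2 (hLM i j)
      positivity
  have h := hmono (Set.left_mem_Icc.2 (by positivity)) (Set.right_mem_Icc.2 (by positivity))
    (by positivity)
  simp only [ζ, L₁, M₁, Real.cos_zero, Real.sin_zero, Real.cos_pi_div_two, Real.sin_pi_div_two,
    one_smul, zero_smul, add_zero, zero_add, ContinuousLinearMap.comp_apply,
    ContinuousLinearMap.coe_fst', ContinuousLinearMap.coe_snd', π] at h
  rw [integral_fun_fst (fun x => logSumExp fun i => L i x),
    integral_fun_snd (fun y => logSumExp fun i => M i y)] at h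
  simpa using h

/-- The **Sudakov–Fernique inequality**: if the increments of one finite centered Gaussian family
are dominated in `L²` by those of another one, then so are the expected maxima. -/
theorem sudakov_fernique {μ : Measure E} [IsGaussian μ] {ν : Measure F} [IsGaussian ν]
    (hμ : μ[id] = 0) (hν : ν[id] = 0) (L : ι → StrongDual ℝ E) (M : ι → StrongDual ℝ F)
    (hLM : ∀ i j, ∫ x, (L i x - L j x) ^ 2 ∂μ ≤ ∫ y, (M i y - M j y) ^ 2 ∂ν) :
    ∫ x, Finset.univ.sup' Finset.univ_nonempty (fun i => L i x) ∂μ ≤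
      ∫ y, Finset.univ.sup' Finset.univ_nonempty (fun i => M i y) ∂ν := by
  have hsmul : ∀ (β : ℝ), 0 ≤ β → ∀ v : ι → ℝ, Finset.univ.sup' Finset.univ_nonempty
      (fun i => β * v i) = β * Finset.univ.sup' Finset.univ_nonempty v := fun β hβ v => by
    rw [Finset.mul₀_sup' hβ]
  have key : ∀ β : ℝ, 0 < β →
      ∫ x, Finset.univ.sup' Finset.univ_nonempty (fun i => L i x) ∂μ ≤
      ∫ y, Finset.univ.sup' Finset.univ_nonempty (fun i => M i y) ∂ν
        + Real.log (Fintype.card ι) / β := by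
    intro β hβ
    have h := integral_logSumExp_le hμ hν (fun i => β • L i) (fun i => β • M i) (fun i j => by
      simp only [smul_apply, smul_eq_mul, ← mul_sub, mul_pow]
      rw [integral_const_mul, integral_const_mul]
      exact mul_le_mul_of_nonneg_left (hLM i j) (by positivity))
    have h1 : β * ∫ x, Finset.univ.sup' Finset.univ_nonempty (fun i => L i x) ∂μ
        ≤ ∫ x, logSumExp (fun i => (β • L i) x) ∂μ := by
      rw [← integral_const_mul]
      refine integral_mono ((integrable_sup' μ L).const_mul _) (integrable_logSumExp μ _) fun x => ?_
      simp only
      rw [← hsmul β hβ.le]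
      exact sup'_le_logSumExp _
    have h2 : ∫ y, logSumExp (fun i => (β • M i) y) ∂ν
        ≤ β * ∫ y, Finset.univ.sup' Finset.univ_nonempty (fun i => M i y) ∂ν
          + Real.log (Fintype.card ι) := by
      have : ∫ y, (β * Finset.univ.sup' Finset.univ_nonempty (fun i => M i y)
          + Real.log (Fintype.card ι)) ∂ν = β * ∫ y, Finset.univ.sup' Finset.univ_nonempty
            (fun i => M i y) ∂ν + Real.log (Fintype.card ι) := by
        rw [integral_add ((integrable_sup' ν M).const_mul _) (integrable_const _), integral_const_mul]
        simp
      rw [← this]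
      refine integral_mono (integrable_logSumExp ν _)
        (((integrable_sup' ν M).const_mul _).add (integrable_const _)) fun y => ?_
      simp only
      rw [← hsmul β hβ.le]
      exact logSumExp_le _
    have h3 := h1.trans (h.trans h2)
    have e : ∫ y, Finset.univ.sup' Finset.univ_nonempty (fun i => M i y) ∂ν
        + Real.log (Fintype.card ι) / β
        = (β * ∫ y, Finset.univ.sup' Finset.univ_nonempty (fun i => M i y) ∂ν
          + Real.log (Fintype.card ι)) / β := by field_simp
    rw [e, le_div_iff₀ hβ]
    linarith
  have hlim : Filter.Tendsto (fun β : ℝ =>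
      ∫ y, Finset.univ.sup' Finset.univ_nonempty (fun i => M i y) ∂ν
        + Real.log (Fintype.card ι) / β) Filter.atTop
      (nhds (∫ y, Finset.univ.sup' Finset.univ_nonempty (fun i => M i y) ∂ν + 0)) :=
    tendsto_const_nhds.add (tendsto_const_nhds.div_atTop Filter.tendsto_id)
  rw [add_zero] at hlim
  exact ge_of_tendsto hlim ((Filter.eventually_gt_atTop 0).mono key)

end SudakovFernique

/-! ### Nuclear positive operators given by orthonormal systems -/

section WeightedProjections

variable {H : Type*} [NormedAddCommGroup H] [InnerProductSpace ℝ H]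
  {ι : Type*} {σ : ι → ℝ} {f : ι → H}

/-- The operator `u ↦ ∑ i, σ i ⟪f i, u⟫ f i`. -/
noncomputable def weightedSum (σ : ι → ℝ) (f : ι → H) : H →L[ℝ] H :=
  ∑' i, σ i • InnerProductSpace.rankOne ℝ (f i) (f i)

lemma norm_smul_rankOne (h0 : ∀ i, 0 ≤ σ i) (hf : Orthonormal ℝ f) (i : ι) :
    ‖σ i • InnerProductSpace.rankOne ℝ (f i) (f i)‖ = σ i := by
  simp [norm_smul, hf.1 i, abs_of_nonneg (h0 i)]

lemma norm_weightedSum_le_tsum (h0 : ∀ i, 0 ≤ σ i) (hσ : Summable σ) (hf : Orthonormal ℝ f) :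
    ‖weightedSum σ f‖ ≤ ∑' i, σ i := by
  refine (norm_tsum_le_tsum_norm ?_).trans_eq ?_ <;> simp only [norm_smul_rankOne h0 hf]
  exact hσ

variable [CompleteSpace H]

lemma summable_smul_rankOne (h0 : ∀ i, 0 ≤ σ i) (hσ : Summable σ) (hf : Orthonormal ℝ f) :
    Summable fun i => σ i • InnerProductSpace.rankOne ℝ (f i) (f i) :=
  Summable.of_norm (by simpa only [norm_smul_rankOne h0 hf] using hσ)

lemma hasSum_inner_weightedSum (h0 : ∀ i, 0 ≤ σ i) (hσ : Summable σ) (hf : Orthonormal ℝ f)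
    (u v : H) : HasSum (fun i => σ i * (⟪f i, u⟫ * ⟪f i, v⟫)) ⟪u, weightedSum σ f v⟫ := by
  have h := (summable_smul_rankOne h0 hσ hf).hasSum.mapL
    ((innerSL ℝ u).comp (ContinuousLinearMap.apply ℝ H v))
  refine HasSum.congr_fun h fun i => Eq.symm ?_
  change ⟪u, σ i • (⟪f i, v⟫ • f i)⟫ = _
  rw [real_inner_smul_right, real_inner_smul_right, real_inner_comm (f i) u]
  ring

lemma inner_weightedSum_comm (h0 : ∀ i, 0 ≤ σ i) (hσ : Summable σ) (hf : Orthonormal ℝ f)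
    (u v : H) : ⟪u, weightedSum σ f v⟫ = ⟪v, weightedSum σ f u⟫ :=
  (hasSum_inner_weightedSum h0 hσ hf u v).unique (by
    simpa only [mul_comm] using hasSum_inner_weightedSum h0 hσ hf v u)

lemma inner_weightedSum_self_nonneg (h0 : ∀ i, 0 ≤ σ i) (hσ : Summable σ) (hf : Orthonormal ℝ f)
    (u : H) : 0 ≤ ⟪u, weightedSum σ f u⟫ :=
  (hasSum_inner_weightedSum h0 hσ hf u u).nonneg fun i => mul_nonneg (h0 i) (mul_self_nonneg _)

lemma norm_weightedSum_le (h0 : ∀ i, 0 ≤ σ i) (hσ : Summable σ) (hf : Orthonormal ℝ f)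
    {c : ℝ} (hc0 : 0 ≤ c) (hc : ∀ i, σ i ≤ c) : ‖weightedSum σ f‖ ≤ c := by
  refine ContinuousLinearMap.opNorm_le_of_re_inner_le hc0 fun u v hu hv => ?_
  have hb : ∀ w : H, ‖w‖ = 1 → ∀ s : Finset ι, ∑ i ∈ s, ⟪f i, w⟫ ^ 2 ≤ 1 := fun w hw s => by
    simpa [hw] using hf.sum_inner_products_le w (s := s)
  change ⟪weightedSum σ f u, v⟫ ≤ c
  rw [real_inner_comm]
  refine hasSum_le_of_sum_le (hasSum_inner_weightedSum h0 hσ hf v u) fun s => ?_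
  calc ∑ i ∈ s, σ i * (⟪f i, v⟫ * ⟪f i, u⟫)
      ≤ ∑ i ∈ s, c * ((⟪f i, v⟫ ^ 2 + ⟪f i, u⟫ ^ 2) / 2) := by
        refine Finset.sum_le_sum fun i _ => ?_
        refine (mul_le_mul_of_nonneg_left ?_ (h0 i)).trans
          (mul_le_mul_of_nonneg_right (hc i) (by positivity))
        nlinarith [sq_nonneg (⟪f i, v⟫ - ⟪f i, u⟫)]
    _ = c * ((∑ i ∈ s, ⟪f i, v⟫ ^ 2 + ∑ i ∈ s, ⟪f i, u⟫ ^ 2) / 2) := by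
        rw [← Finset.mul_sum, ← Finset.sum_div, Finset.sum_add_distrib]
    _ ≤ c * 1 := mul_le_mul_of_nonneg_left (by linarith [hb v hv s, hb u hu s]) hc0
    _ = c := mul_one c

lemma sum_inner_weightedSum_le (h0 : ∀ i, 0 ≤ σ i) (hσ : Summable σ) (hf : Orthonormal ℝ f)
    {κ : Type*} [Fintype κ] {e : κ → H} (he : Orthonormal ℝ e) :
    ∑ k, ⟪e k, weightedSum σ f (e k)⟫ ≤ ∑' i, σ i := by
  refine hasSum_le (fun i => ?_)
    (hasSum_sum fun k _ => hasSum_inner_weightedSum h0 hσ hf (e k) (e k)) hσ.hasSum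
  rw [← Finset.mul_sum]
  refine mul_le_of_le_one_right (h0 i) ?_
  have := he.sum_inner_products_le (f i) (s := Finset.univ)
  simpa [hf.1 i, real_inner_comm (f i), pow_two] using this

lemma hasSum_trace_weightedSum (h0 : ∀ i, 0 ≤ σ i) (hσ : Summable σ) (hf : Orthonormal ℝ f)
    {κ : Type*} (b : HilbertBasis κ ℝ H) :
    HasSum (fun k => ⟪b k, weightedSum σ f (b k)⟫) (∑' i, σ i) := by
  have row : ∀ i, HasSum (fun k => σ i * (⟪f i, b k⟫ * ⟪f i, b k⟫)) (σ i) := fun i => by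
    have := (b.hasSum_inner_mul_inner (f i) (f i)).mul_left (σ i)
    simpa [hf.1 i, real_inner_comm (f i)] using this
  have hs : Summable fun p : ι × κ => σ p.1 * (⟪f p.1, b p.2⟫ * ⟪f p.1, b p.2⟫) := by
    refine (summable_prod_of_nonneg fun p => mul_nonneg (h0 _) (mul_self_nonneg _)).2
      ⟨fun i => (row i).summable, ?_⟩
    simpa only [(row _).tsum_eq] using hσ
  have htot : HasSum (fun p : ι × κ => σ p.1 * (⟪f p.1, b p.2⟫ * ⟪f p.1, b p.2⟫)) (∑' i, σ i) := by
    have := (hs.hasSum.prod_fiberwise row).tsum_eq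
    rw [this]
    exact hs.hasSum
  exact ((Equiv.prodComm κ ι).hasSum_iff.2 htot).prod_fiberwise fun k =>
    hasSum_inner_weightedSum h0 hσ hf (b k) (b k)

end WeightedProjections

/-! ### Singular value decompositions -/

section SVD

variable {H : Type*} [NormedAddCommGroup H] [InnerProductSpace ℝ H]
  {ι : Type*} {T : H →L[ℝ] H} {σ : ι → ℝ} {f g : ι → H}

lemma IsSVD.apply_right (h : IsSVD T σ f g) (i : ι) : T (g i) = σ i • f i := by
  classical
  refine (h.hasSum (g i)).unique ?_
  convert hasSum_ite_eq i (σ i • f i) using 2 with j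
  rw [orthonormal_iff_ite.1 h.right_orthonormal j i]
  split_ifs with hji
  · subst hji; simp
  · simp

lemma IsSVD.singularValue_eq (h : IsSVD T σ f g) (i : ι) : σ i = ⟪f i, T (g i)⟫ := by
  rw [h.apply_right, real_inner_smul_right, real_inner_self_eq_norm_sq, h.left_orthonormal.1 i]
  simp

variable [CompleteSpace H]

lemma IsSVD.tildeCov_eq (h : IsSVD T σ f g) (hσ : Summable σ) :
    tildeCov σ f g = (1 / 2 : ℝ) • (weightedSum σ f + weightedSum σ g) := by
  rw [tildeCov, weightedSum, weightedSum,
    ← (summable_smul_rankOne h.nonneg hσ h.left_orthonormal).tsum_add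
      (summable_smul_rankOne h.nonneg hσ h.right_orthonormal)]
  simp_rw [smul_add]

/-- The bilinear form of an operator is dominated by the quadratic forms built from the left and
from the right singular vectors. -/
lemma IsSVD.two_mul_inner_le (h : IsSVD T σ f g) (hσ : Summable σ) (u v : H) :
    2 * ⟪u, T v⟫ ≤ ⟪u, weightedSum σ f u⟫ + ⟪v, weightedSum σ g v⟫ := by
  have h1 : HasSum (fun i => 2 * (σ i * (⟪f i, u⟫ * ⟪g i, v⟫))) (2 * ⟪u, T v⟫) := by
    have := ((h.hasSum v).mapL (innerSL ℝ u)).mul_left 2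
    refine HasSum.congr_fun this fun i => Eq.symm ?_
    change 2 * ⟪u, (σ i * ⟪g i, v⟫) • f i⟫ = _
    rw [real_inner_smul_right, real_inner_comm (f i) u]
    ring
  refine hasSum_le (fun i => ?_) h1
    ((hasSum_inner_weightedSum h.nonneg hσ h.left_orthonormal u u).add
      (hasSum_inner_weightedSum h.nonneg hσ h.right_orthonormal v v))
  nlinarith [mul_nonneg (h.nonneg i) (sq_nonneg (⟪f i, u⟫ - ⟪g i, v⟫))]

end SVD

/-! ### Cross-covariance operators of a stationary process -/

section CrossCovariance

variable {H : Type*} [NormedAddCommGroup H] [InnerProductSpace ℝ H] [CompleteSpace H]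
  {Ω : Type*} [MeasurableSpace Ω] {P : Measure Ω} {x : ℤ → Ω → H}

lemma integrable_inner_mul_inner (hx : ∀ t, MemLp (x t) 2 P) (s t : ℤ) (a b : H) :
    Integrable (fun ω => ⟪x s ω, a⟫ * ⟪x t ω, b⟫) P :=
  ((hx s).inner_const a).integrable_mul ((hx t).inner_const b)

lemma continuous_rankOne :
    Continuous fun p : H × H => InnerProductSpace.rankOne ℝ p.1 p.2 :=
  (InnerProductSpace.rankOne ℝ (E := H) (F := H)).continuous₂

lemma integrable_rankOne (hx : ∀ t, MemLp (x t) 2 P) (s t : ℤ) :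
    Integrable (fun ω => InnerProductSpace.rankOne ℝ (x s ω) (x t ω)) P := by
  have hm : AEStronglyMeasurable (fun ω => InnerProductSpace.rankOne ℝ (x s ω) (x t ω)) P := by
    have h2 : AEStronglyMeasurable (fun ω => (x s ω, x t ω)) P := (hx s).1.prodMk (hx t).1
    change AEStronglyMeasurable ((fun p : H × H => InnerProductSpace.rankOne ℝ p.1 p.2) ∘
      fun ω => (x s ω, x t ω)) P
    exact continuous_rankOne.comp_aestronglyMeasurable h2
  have hi : Integrable (fun ω => ‖x s ω‖ * ‖x t ω‖) P := (hx s).norm.integrable_mul (hx t).norm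
  refine hi.mono' hm (.of_forall fun ω => ?_)
  rw [InnerProductSpace.norm_rankOne]

lemma inner_crossCov (hx : ∀ t, MemLp (x t) 2 P) (h : ℤ) (a b : H) :
    ⟪a, crossCov P x h b⟫ = ∫ ω, ⟪x 0 ω, a⟫ * ⟪x h ω, b⟫ ∂P := by
  have := ((innerSL ℝ a).comp (ContinuousLinearMap.apply ℝ H b)).integral_comp_comm
    (integrable_rankOne hx 0 h)
  change ((innerSL ℝ a).comp (ContinuousLinearMap.apply ℝ H b)) (crossCov P x h) = _
  rw [crossCov, ← this]
  refine integral_congr_ae (.of_forall fun ω => ?_)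
  change ⟪a, ⟪x h ω, b⟫ • x 0 ω⟫ = _
  rw [real_inner_smul_right, real_inner_comm (x 0 ω) a, mul_comm]

lemma IsStationary.integral_comp_pair [SecondCountableTopology H] [MeasurableSpace H] [BorelSpace H]
    (hs : IsStationary P x) (hx : ∀ t, AEMeasurable (x t) P) {E : Type*} [NormedAddCommGroup E]
    [NormedSpace ℝ E] {F : H → H → E} (hF : Continuous fun p : H × H => F p.1 p.2) (s t h : ℤ) :
    ∫ ω, F (x (s + h) ω) (x (t + h) ω) ∂P = ∫ ω, F (x s ω) (x t ω) ∂P := by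
  let I : Finset ℤ := {s, t}
  let i : I := ⟨s, by simp [I]⟩
  let j : I := ⟨t, by simp [I]⟩
  have hij : Continuous fun z : I → H => (z i, z j) := by fun_prop
  have hG : Continuous fun z : I → H => F (z i) (z j) := hF.comp hij
  have e := hs h I
  have e1 := integral_map (μ := P) (φ := fun ω (t : I) => x ((t : ℤ) + h) ω)
    (aemeasurable_pi_lambda _ fun t => hx _) (hG.stronglyMeasurable.aestronglyMeasurable)
  have e2 := integral_map (μ := P) (φ := fun ω (t : I) => x (t : ℤ) ω)
    (aemeasurable_pi_lambda _ fun t => hx _) (hG.stronglyMeasurable.aestronglyMeasurable)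
  rw [e, e2] at e1
  exact e1.symm

variable [SecondCountableTopology H] [MeasurableSpace H] [BorelSpace H]

lemma integral_inner_mul_inner (hs : IsStationary P x) (hx : ∀ t, MemLp (x t) 2 P) (s t : ℤ)
    (a b : H) : ∫ ω, ⟪x s ω, a⟫ * ⟪x t ω, b⟫ ∂P = ⟪a, crossCov P x (t - s) b⟫ := by
  rw [inner_crossCov hx]
  have := hs.integral_comp_pair (fun t => (hx t).1.aemeasurable)
    (F := fun u v => ⟪u, a⟫ * ⟪v, b⟫) (by fun_prop) 0 (t - s) s
  simpa using this

lemma integral_norm_sq_eq (hs : IsStationary P x) (hx : ∀ t, MemLp (x t) 2 P) (t : ℤ) :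
    ∫ ω, ‖x t ω‖ ^ 2 ∂P = ∫ ω, ‖x 0 ω‖ ^ 2 ∂P := by
  have := hs.integral_comp_pair (fun t => (hx t).1.aemeasurable)
    (F := fun u _ => ‖u‖ ^ 2) (by fun_prop) 0 0 t
  simpa using this

lemma integral_rankOne_eq_crossCov (hs : IsStationary P x) (hx : ∀ t, MemLp (x t) 2 P) (t : ℤ) :
    ∫ ω, InnerProductSpace.rankOne ℝ (x t ω) (x t ω) ∂P = crossCov P x 0 := by
  have := hs.integral_comp_pair (fun t => (hx t).1.aemeasurable)
    (F := fun u v => InnerProductSpace.rankOne ℝ u v) continuous_rankOne 0 0 t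
  simpa [crossCov] using this

lemma inner_crossCov_zero_self (hx : ∀ t, MemLp (x t) 2 P) (a : H) :
    ⟪a, crossCov P x 0 a⟫ = ∫ ω, ⟪x 0 ω, a⟫ ^ 2 ∂P := by
  rw [inner_crossCov hx]
  simp_rw [pow_two]

lemma inner_crossCov_zero_comm (hx : ∀ t, MemLp (x t) 2 P) (a b : H) :
    ⟪a, crossCov P x 0 b⟫ = ⟪b, crossCov P x 0 a⟫ := by
  rw [inner_crossCov hx, inner_crossCov hx]
  simp_rw [mul_comm]

lemma norm_crossCov_zero_le : ‖crossCov P x 0‖ ≤ ∫ ω, ‖x 0 ω‖ ^ 2 ∂P := by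
  refine (norm_integral_le_integral_norm _).trans_eq ?_
  simp [pow_two]

lemma sum_inner_crossCov_zero_le (hx : ∀ t, MemLp (x t) 2 P) {κ : Type*} [Fintype κ] {e : κ → H}
    (he : Orthonormal ℝ e) : ∑ k, ⟪e k, crossCov P x 0 (e k)⟫ ≤ ∫ ω, ‖x 0 ω‖ ^ 2 ∂P := by
  simp_rw [inner_crossCov_zero_self hx]
  have hi : ∀ k, Integrable (fun ω => ⟪x 0 ω, e k⟫ ^ 2) P := fun k =>
    ((hx 0).inner_const (e k)).integrable_sq
  rw [← integral_finsetSum _ fun k _ => hi k]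
  refine integral_mono (integrable_finsetSum _ fun k _ => hi k) (hx 0).norm.integrable_sq fun ω => ?_
  simpa [real_inner_comm] using he.sum_inner_products_le (x 0 ω) (s := Finset.univ)

lemma countable_of_orthonormal {κ : Type*} {e : κ → H}
    (he : Orthonormal ℝ e) : Countable κ := by
  refine Pairwise.countable_of_isOpen_disjoint (s := fun k => Metric.ball (e k) (1 / 2))
    (fun k l hkl => ?_) (fun _ => Metric.isOpen_ball)
    (fun k => ⟨e k, Metric.mem_ball_self (by norm_num)⟩)
  refine Metric.ball_disjoint_ball ?_
  have h2 : ‖e k - e l‖ ^ 2 = 2 := by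
    rw [norm_sub_sq_real, he.1, he.1, he.2 hkl]; norm_num
  rw [dist_eq_norm]
  nlinarith [norm_nonneg (e k - e l)]

lemma hasSum_trace_crossCov_zero (hx : ∀ t, MemLp (x t) 2 P) {κ : Type*}
    (b : HilbertBasis κ ℝ H) :
    HasSum (fun k => ⟪b k, crossCov P x 0 (b k)⟫) (∫ ω, ‖x 0 ω‖ ^ 2 ∂P) := by
  have := countable_of_orthonormal b.orthonormal
  simp_rw [inner_crossCov_zero_self hx]
  have hp : ∀ ω, HasSum (fun k => ⟪x 0 ω, b k⟫ ^ 2) (‖x 0 ω‖ ^ 2) := fun ω => by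
    have := b.hasSum_inner_mul_inner (x 0 ω) (x 0 ω)
    rw [real_inner_self_eq_norm_sq] at this
    refine HasSum.congr_fun this fun k => ?_
    rw [pow_two, real_inner_comm (x 0 ω) (b k)]
  refine hasSum_integral_of_dominated_convergence (fun k ω => ⟪x 0 ω, b k⟫ ^ 2)
    (fun k => ((hx 0).inner_const (b k)).integrable_sq.aestronglyMeasurable)
    (fun k => .of_forall fun ω => by simp) (.of_forall fun ω => (hp ω).summable) ?_
    (.of_forall hp)
  simp_rw [(hp _).tsum_eq]
  exact (hx 0).norm.integrable_sq

variable {ι : Type*} {σ : ι → ℝ} {f g : ι → H} {h : ℤ}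

/-- The singular values of a cross-covariance operator are always summable: each of them is a
cross-moment of coordinates, so that Bessel's inequality applies under the expectation. -/
lemma IsSVD.summable_crossCov (hx : ∀ t, MemLp (x t) 2 P) (hsvd : IsSVD (crossCov P x h) σ f g) :
    Summable σ := by
  refine summable_of_sum_le hsvd.nonneg
    (c := ∫ ω, (‖x 0 ω‖ ^ 2 + ‖x h ω‖ ^ 2) ∂P) fun s => ?_
  simp_rw [hsvd.singularValue_eq, inner_crossCov hx]
  have hi := fun i => integrable_inner_mul_inner hx 0 h (f i) (g i)
  rw [← integral_finsetSum _ fun i _ => hi i]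
  refine integral_mono (integrable_finsetSum _ fun i _ => hi i)
    ((hx 0).norm.integrable_sq.add (hx h).norm.integrable_sq) fun ω => ?_
  have hf : ∑ i ∈ s, ⟪x 0 ω, f i⟫ ^ 2 ≤ ‖x 0 ω‖ ^ 2 := by
    simpa [real_inner_comm] using hsvd.left_orthonormal.sum_inner_products_le (x 0 ω) (s := s)
  have hg : ∑ i ∈ s, ⟪x h ω, g i⟫ ^ 2 ≤ ‖x h ω‖ ^ 2 := by
    simpa [real_inner_comm] using hsvd.right_orthonormal.sum_inner_products_le (x h ω) (s := s)
  refine le_trans (Finset.sum_le_sum fun i _ => ?_)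
    ((Finset.sum_add_distrib (f := fun i => ⟪x 0 ω, f i⟫ ^ 2)
      (g := fun i => ⟪x h ω, g i⟫ ^ 2)).trans_le (add_le_add hf hg))
  nlinarith [sq_nonneg (⟪x 0 ω, f i⟫ - ⟪x h ω, g i⟫), sq_nonneg (⟪x 0 ω, f i⟫),
    sq_nonneg (⟪x h ω, g i⟫)]

/-- By stationarity and the Cauchy–Schwarz inequality, the lag-zero covariance operator dominates
all singular values of the cross-covariance operators. -/
lemma IsSVD.le_norm_crossCov_zero (hs : IsStationary P x) (hx : ∀ t, MemLp (x t) 2 P)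
    (hsvd : IsSVD (crossCov P x h) σ f g) (i : ι) : σ i ≤ ‖crossCov P x 0‖ := by
  have hq : ∀ t, ∀ u : H, ‖u‖ = 1 → ∫ ω, ⟪x t ω, u⟫ ^ 2 ∂P ≤ ‖crossCov P x 0‖ := fun t u hu => by
    have e := integral_inner_mul_inner hs hx t t u u
    simp_rw [← pow_two, sub_self] at e
    rw [e]
    refine (real_inner_le_norm _ _).trans ?_
    simpa [hu] using (crossCov P x 0).le_opNorm u
  rw [hsvd.singularValue_eq, inner_crossCov hx]
  have h1 := hq 0 (f i) (hsvd.left_orthonormal.1 i)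
  have h2 := hq h (g i) (hsvd.right_orthonormal.1 i)
  have i1 := ((hx 0).inner_const (f i)).integrable_sq
  have i2 := ((hx h).inner_const (g i)).integrable_sq
  calc ∫ ω, ⟪x 0 ω, f i⟫ * ⟪x h ω, g i⟫ ∂P
      ≤ ∫ ω, (1 / 2) * (⟪x 0 ω, f i⟫ ^ 2 + ⟪x h ω, g i⟫ ^ 2) ∂P := by
        refine integral_mono (integrable_inner_mul_inner hx 0 h _ _) ((i1.add i2).const_mul _)
          fun ω => ?_
        nlinarith [sq_nonneg (⟪x 0 ω, f i⟫ - ⟪x h ω, g i⟫)]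
    _ = (1 / 2) * (∫ ω, ⟪x 0 ω, f i⟫ ^ 2 ∂P + ∫ ω, ⟪x h ω, g i⟫ ^ 2 ∂P) := by
        rw [integral_const_mul, integral_add i1 i2]
    _ ≤ ‖crossCov P x 0‖ := by linarith

end CrossCovariance

/-! ### The integrated covariance operator -/

section IntegratedCovariance

variable {H : Type*} [NormedAddCommGroup H] [InnerProductSpace ℝ H] [CompleteSpace H]
  [SecondCountableTopology H] [MeasurableSpace H] [BorelSpace H]
  {Ω : Type*} [MeasurableSpace Ω] {P : Measure Ω} {x : ℤ → Ω → H}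
  {n : ℕ} {ι : ℕ → Type*} {σ : ∀ h, ι h → ℝ} {f g : ∀ h, ι h → H}

/-- The value `E‖x 0‖² + 2 ∑ h, ∑ i, σ h i` of the trace of the integrated covariance operator. -/
noncomputable def integratedTrace (P : Measure Ω) (x : ℤ → Ω → H) (σ : ∀ h, ι h → ℝ) (n : ℕ) : ℝ :=
  ∫ ω, ‖x 0 ω‖ ^ 2 ∂P + 2 * ∑ h ∈ Finset.Ico 1 n, ∑' i, σ h i

lemma integratedCov_eq (hx : ∀ t, MemLp (x t) 2 P)
    (hsvd : ∀ h ∈ Finset.Ico 1 n, IsSVD (crossCov P x (h : ℤ)) (σ h) (f h) (g h)) :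
    integratedCov P x σ f g n = crossCov P x 0 +
      ∑ h ∈ Finset.Ico 1 n, (weightedSum (σ h) (f h) + weightedSum (σ h) (g h)) := by
  rw [integratedCov, Finset.smul_sum]
  congr 1
  refine Finset.sum_congr rfl fun h hh => ?_
  rw [(hsvd h hh).tildeCov_eq ((hsvd h hh).summable_crossCov hx), smul_smul]
  norm_num

lemma inner_integratedCov (hx : ∀ t, MemLp (x t) 2 P)
    (hsvd : ∀ h ∈ Finset.Ico 1 n, IsSVD (crossCov P x (h : ℤ)) (σ h) (f h) (g h)) (u v : H) :
    ⟪u, integratedCov P x σ f g n v⟫ = ⟪u, crossCov P x 0 v⟫ +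
      ∑ h ∈ Finset.Ico 1 n,
        (⟪u, weightedSum (σ h) (f h) v⟫ + ⟪u, weightedSum (σ h) (g h) v⟫) := by
  rw [integratedCov_eq hx hsvd, add_apply, sum_apply, inner_add_right, inner_sum]
  simp only [add_apply, inner_add_right]

lemma inner_integratedCov_comm (hx : ∀ t, MemLp (x t) 2 P)
    (hsvd : ∀ h ∈ Finset.Ico 1 n, IsSVD (crossCov P x (h : ℤ)) (σ h) (f h) (g h)) (u v : H) :
    ⟪u, integratedCov P x σ f g n v⟫ = ⟪v, integratedCov P x σ f g n u⟫ := by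
  rw [inner_integratedCov hx hsvd, inner_integratedCov hx hsvd, inner_crossCov_zero_comm hx u v]
  congr 1
  refine Finset.sum_congr rfl fun h hh => ?_
  have hσ := (hsvd h hh).summable_crossCov hx
  rw [inner_weightedSum_comm (hsvd h hh).nonneg hσ (hsvd h hh).left_orthonormal u v,
    inner_weightedSum_comm (hsvd h hh).nonneg hσ (hsvd h hh).right_orthonormal u v]

lemma inner_integratedCov_self_nonneg (hx : ∀ t, MemLp (x t) 2 P)
    (hsvd : ∀ h ∈ Finset.Ico 1 n, IsSVD (crossCov P x (h : ℤ)) (σ h) (f h) (g h)) (u : H) :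
    0 ≤ ⟪u, integratedCov P x σ f g n u⟫ := by
  rw [inner_integratedCov hx hsvd, inner_crossCov_zero_self hx]
  refine add_nonneg (integral_nonneg fun ω => sq_nonneg _) (Finset.sum_nonneg fun h hh => ?_)
  have hσ := (hsvd h hh).summable_crossCov hx
  exact add_nonneg
    (inner_weightedSum_self_nonneg (hsvd h hh).nonneg hσ (hsvd h hh).left_orthonormal u)
    (inner_weightedSum_self_nonneg (hsvd h hh).nonneg hσ (hsvd h hh).right_orthonormal u)

lemma hasSum_trace_integratedCov (hx : ∀ t, MemLp (x t) 2 P)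
    (hsvd : ∀ h ∈ Finset.Ico 1 n, IsSVD (crossCov P x (h : ℤ)) (σ h) (f h) (g h))
    {κ : Type*} (b : HilbertBasis κ ℝ H) :
    HasSum (fun k => ⟪b k, integratedCov P x σ f g n (b k)⟫) (integratedTrace P x σ n) := by
  simp_rw [inner_integratedCov hx hsvd]
  rw [integratedTrace, Finset.mul_sum]
  refine (hasSum_trace_crossCov_zero hx b).add (hasSum_sum fun h hh => ?_)
  have hσ := (hsvd h hh).summable_crossCov hx
  rw [two_mul]
  exact (hasSum_trace_weightedSum (hsvd h hh).nonneg hσ (hsvd h hh).left_orthonormal b).add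
    (hasSum_trace_weightedSum (hsvd h hh).nonneg hσ (hsvd h hh).right_orthonormal b)

lemma sum_inner_integratedCov_le (hx : ∀ t, MemLp (x t) 2 P)
    (hsvd : ∀ h ∈ Finset.Ico 1 n, IsSVD (crossCov P x (h : ℤ)) (σ h) (f h) (g h))
    {κ : Type*} [Fintype κ] {e : κ → H} (he : Orthonormal ℝ e) :
    ∑ k, ⟪e k, integratedCov P x σ f g n (e k)⟫ ≤ integratedTrace P x σ n := by
  simp_rw [inner_integratedCov hx hsvd]
  rw [integratedTrace, Finset.mul_sum, Finset.sum_add_distrib, Finset.sum_comm]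
  refine add_le_add (sum_inner_crossCov_zero_le hx he) (Finset.sum_le_sum fun h hh => ?_)
  have hσ := (hsvd h hh).summable_crossCov hx
  rw [two_mul, Finset.sum_add_distrib]
  exact add_le_add
    (sum_inner_weightedSum_le (hsvd h hh).nonneg hσ (hsvd h hh).left_orthonormal he)
    (sum_inner_weightedSum_le (hsvd h hh).nonneg hσ (hsvd h hh).right_orthonormal he)

lemma norm_integratedCov_le_trace (hx : ∀ t, MemLp (x t) 2 P)
    (hsvd : ∀ h ∈ Finset.Ico 1 n, IsSVD (crossCov P x (h : ℤ)) (σ h) (f h) (g h)) :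
    ‖integratedCov P x σ f g n‖ ≤ integratedTrace P x σ n := by
  rw [integratedCov_eq hx hsvd, integratedTrace, Finset.mul_sum]
  refine (norm_add_le _ _).trans (add_le_add norm_crossCov_zero_le
    ((norm_sum_le _ _).trans (Finset.sum_le_sum fun h hh => ?_)))
  have hσ := (hsvd h hh).summable_crossCov hx
  rw [two_mul]
  exact (norm_add_le _ _).trans (add_le_add
    (norm_weightedSum_le_tsum (hsvd h hh).nonneg hσ (hsvd h hh).left_orthonormal)
    (norm_weightedSum_le_tsum (hsvd h hh).nonneg hσ (hsvd h hh).right_orthonormal))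

lemma norm_integratedCov_le (hs : IsStationary P x) (hx : ∀ t, MemLp (x t) 2 P) (hn : 1 ≤ n)
    (hsvd : ∀ h ∈ Finset.Ico 1 n, IsSVD (crossCov P x (h : ℤ)) (σ h) (f h) (g h)) :
    ‖integratedCov P x σ f g n‖ ≤ 2 * n * ‖crossCov P x 0‖ := by
  rw [integratedCov_eq hx hsvd]
  have hsum : ‖∑ h ∈ Finset.Ico 1 n, (weightedSum (σ h) (f h) + weightedSum (σ h) (g h))‖
      ≤ ∑ _h ∈ Finset.Ico 1 n, 2 * ‖crossCov P x 0‖ := by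
    refine (norm_sum_le _ _).trans (Finset.sum_le_sum fun h hh => ?_)
    have hσ := (hsvd h hh).summable_crossCov hx
    have hc := (hsvd h hh).le_norm_crossCov_zero hs hx
    rw [two_mul]
    exact (norm_add_le _ _).trans (add_le_add
      (norm_weightedSum_le (hsvd h hh).nonneg hσ (hsvd h hh).left_orthonormal (norm_nonneg _) hc)
      (norm_weightedSum_le (hsvd h hh).nonneg hσ (hsvd h hh).right_orthonormal (norm_nonneg _) hc))
  refine (norm_add_le _ _).trans ((add_le_add_right hsum _).trans ?_)
  rw [Finset.sum_const, Nat.card_Ico, nsmul_eq_mul, Nat.cast_sub hn]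
  push_cast
  linarith [norm_nonneg (crossCov P x 0)]

/-- The covariance operator of `(x 1, …, x n)` is dominated, in the order of positive operators, by
the block-diagonal operator all of whose blocks are the integrated covariance operator. -/
theorem integral_sum_inner_sq_le (hs : IsStationary P x) (hx : ∀ t, MemLp (x t) 2 P)
    (hsvd : ∀ h ∈ Finset.Ico 1 n, IsSVD (crossCov P x (h : ℤ)) (σ h) (f h) (g h)) (a : ℤ → H) :
    ∫ ω, (∑ t ∈ Finset.Icc (1 : ℤ) n, ⟪x t ω, a t⟫) ^ 2 ∂P ≤
      ∑ t ∈ Finset.Icc (1 : ℤ) n, ⟪a t, integratedCov P x σ f g n (a t)⟫ := by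
  have reindex : ∀ φ : ℤ → ℝ, ∑ t ∈ Finset.Icc (1 : ℤ) n, φ t
      = ∑ i ∈ Finset.range n, φ (i + 1) := fun φ => by
    symm
    refine Finset.sum_nbij (fun i : ℕ => (i : ℤ) + 1) (fun i hi => ?_) (fun i _ j _ hij => ?_)
      (fun t ht => ?_) (fun _ _ => rfl)
    · have := Finset.mem_range.1 hi
      exact Finset.mem_Icc.2 ⟨by omega, by omega⟩
    · simpa using hij
    · have := Finset.mem_Icc.1 (Finset.mem_coe.1 ht)
      exact ⟨(t - 1).toNat, by simp; omega, by simp; omega⟩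
  simp_rw [reindex]
  set d : ℕ → H := fun i => a (i + 1) with hd
  set c : ℕ → ℕ → ℝ := fun i j => ∫ ω, ⟪x (i + 1) ω, d i⟫ * ⟪x (j + 1) ω, d j⟫ ∂P with hc
  let F : ℕ → H → ℝ := fun h u => ⟪u, weightedSum (σ h) (f h) u⟫
  let G : ℕ → H → ℝ := fun h u => ⟪u, weightedSum (σ h) (g h) u⟫
  have F0 : ∀ h ∈ Finset.Ico 1 n, ∀ u, 0 ≤ F h u := fun h hh u =>
    inner_weightedSum_self_nonneg (hsvd h hh).nonneg ((hsvd h hh).summable_crossCov hx)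
      (hsvd h hh).left_orthonormal u
  have G0 : ∀ h ∈ Finset.Ico 1 n, ∀ u, 0 ≤ G h u := fun h hh u =>
    inner_weightedSum_self_nonneg (hsvd h hh).nonneg ((hsvd h hh).summable_crossCov hx)
      (hsvd h hh).right_orthonormal u
  have csymm : ∀ i j, c i j = c j i := fun i j => by simp only [hc, mul_comm]
  have cdiag : ∀ i, c i i = ⟪d i, crossCov P x 0 (d i)⟫ := fun i => by
    simp only [hc]
    rw [integral_inner_mul_inner hs hx, sub_self]
  have cupper : ∀ i ∈ Finset.range n, ∀ j ∈ Finset.range n, i < j →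
      2 * c i j ≤ F (j - i) (d i) + G (j - i) (d j) := fun i _ j hj hij => by
    have hjn := Finset.mem_range.1 hj
    have hh : j - i ∈ Finset.Ico 1 n := Finset.mem_Ico.2 ⟨by omega, by omega⟩
    simp only [hc]
    rw [integral_inner_mul_inner hs hx]
    have e : ((j : ℤ) + 1 - (i + 1)) = ((j - i : ℕ) : ℤ) := by omega
    rw [e]
    exact (hsvd _ hh).two_mul_inner_le ((hsvd _ hh).summable_crossCov hx) _ _
  have sumF : ∀ i, ∑ j ∈ Finset.range n, (if i < j then F (j - i) (d i) else 0)
      ≤ ∑ h ∈ Finset.Ico 1 n, F h (d i) := fun i => by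
    rw [← Finset.sum_filter, ← Finset.sum_image (f := fun h => F h (d i)) (g := fun j => j - i)]
    · refine Finset.sum_le_sum_of_subset_of_nonneg (fun h hh => ?_) fun h hh _ => F0 h hh _
      obtain ⟨j, hj, rfl⟩ := Finset.mem_image.1 hh
      simp only [Finset.mem_filter, Finset.mem_range] at hj
      exact Finset.mem_Ico.2 ⟨by omega, by omega⟩
    · intro j hj k hk hjk
      simp only [Finset.coe_filter, Finset.mem_range, Set.mem_ofPred_eq] at hj hk
      simp only at hjk
      omega
  have sumG : ∀ j ∈ Finset.range n, ∑ i ∈ Finset.range n, (if i < j then G (j - i) (d j) else 0)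
      ≤ ∑ h ∈ Finset.Ico 1 n, G h (d j) := fun j hjn => by
    rw [← Finset.sum_filter, ← Finset.sum_image (f := fun h => G h (d j)) (g := fun i => j - i)]
    · refine Finset.sum_le_sum_of_subset_of_nonneg (fun h hh => ?_) fun h hh _ => G0 h hh _
      obtain ⟨i, hi, rfl⟩ := Finset.mem_image.1 hh
      simp only [Finset.mem_filter, Finset.mem_range] at hi hjn
      exact Finset.mem_Ico.2 ⟨by omega, by omega⟩
    · intro i hi k hk hik
      simp only [Finset.coe_filter, Finset.mem_range, Set.mem_ofPred_eq] at hi hk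
      simp only at hik
      omega
  have hint : ∀ i j : ℕ, Integrable (fun ω => ⟪x (i + 1) ω, d i⟫ * ⟪x (j + 1) ω, d j⟫) P :=
    fun i j => integrable_inner_mul_inner hx _ _ _ _
  calc ∫ ω, (∑ i ∈ Finset.range n, ⟪x (i + 1) ω, a (i + 1)⟫) ^ 2 ∂P
      = ∑ i ∈ Finset.range n, ∑ j ∈ Finset.range n, c i j := by
        simp_rw [pow_two, Finset.sum_mul_sum]
        rw [integral_finsetSum _ fun i _ => integrable_finsetSum _ fun j _ => hint i j]
        exact Finset.sum_congr rfl fun i _ => integral_finsetSum _ fun j _ => hint i j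
    _ = ∑ i ∈ Finset.range n, c i i
        + ∑ i ∈ Finset.range n, ∑ j ∈ Finset.range n, (if i < j then 2 * c i j else 0) := by
        -- fold the entries below the diagonal onto those above it
        have e : ∀ i j, c i j = (if i = j then c i i else 0) + (if i < j then c i j else 0)
            + (if j < i then c j i else 0) := fun i j => by
          rcases lt_trichotomy i j with h | h | h
          · simp [h, h.ne, h.not_gt]
          · simp [h]
          · simp [h, h.ne', h.not_gt, csymm i j]
        have e2 : ∑ i ∈ Finset.range n, ∑ j ∈ Finset.range n, (if j < i then c j i else 0)
            = ∑ i ∈ Finset.range n, ∑ j ∈ Finset.range n, (if i < j then c i j else 0) :=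
          Finset.sum_comm
        have e3 : ∑ i ∈ Finset.range n, ∑ j ∈ Finset.range n, (if i = j then c i i else 0)
            = ∑ i ∈ Finset.range n, c i i :=
          Finset.sum_congr rfl fun i hi => by rw [Finset.sum_ite_eq, if_pos hi]
        rw [Finset.sum_congr rfl fun i _ => Finset.sum_congr rfl fun j _ => e i j]
        simp_rw [Finset.sum_add_distrib]
        rw [e2, e3, add_assoc, ← Finset.sum_add_distrib]
        congr 1
        refine Finset.sum_congr rfl fun i _ => ?_
        rw [← Finset.sum_add_distrib]
        refine Finset.sum_congr rfl fun j _ => ?_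
        split_ifs <;> ring
    _ ≤ ∑ i ∈ Finset.range n, c i i + ∑ i ∈ Finset.range n, ∑ j ∈ Finset.range n,
          ((if i < j then F (j - i) (d i) else 0) + (if i < j then G (j - i) (d j) else 0)) := by
        gcongr with i hi j hj
        split_ifs with hij
        · exact cupper i hi j hj hij
        · simp
    _ ≤ ∑ i ∈ Finset.range n, c i i + (∑ i ∈ Finset.range n, ∑ h ∈ Finset.Ico 1 n, F h (d i)
          + ∑ j ∈ Finset.range n, ∑ h ∈ Finset.Ico 1 n, G h (d j)) := by
        simp_rw [Finset.sum_add_distrib]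
        refine add_le_add le_rfl (add_le_add (Finset.sum_le_sum fun i _ => sumF i) ?_)
        rw [Finset.sum_comm]
        exact Finset.sum_le_sum fun j hj => sumG j hj
    _ = ∑ i ∈ Finset.range n, ⟪a (i + 1), integratedCov P x σ f g n (a (i + 1))⟫ := by
        rw [← Finset.sum_add_distrib, ← Finset.sum_add_distrib]
        refine Finset.sum_congr rfl fun i _ => ?_
        rw [inner_integratedCov hx hsvd, cdiag, Finset.sum_add_distrib]

end IntegratedCovariance

/-! ### A Chevet-type inequality -/

section Chevet

/-- The elementary inequality behind Chevet's inequality: the increments of the bilinear process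
`⟪G, w ⊗ p⟫` are dominated by those of the decoupled process `R ⟪g, p⟫ + ‖p‖ ⟪g', w⟫`, provided
that `‖w‖ ≤ R`. -/
lemma sum_sum_sub_sq_le {M I : Type*} [Fintype M] [Fintype I] (p p' : M → ℝ) (w w' : I → ℝ) {R : ℝ}
    (hw : ∑ t, w t ^ 2 ≤ R ^ 2) (hw' : ∑ t, w' t ^ 2 ≤ R ^ 2) :
    ∑ t, ∑ m, (w t * p m - w' t * p' m) ^ 2 ≤
      R ^ 2 * ∑ m, (p m - p' m) ^ 2 +
        ∑ t, (√(∑ m, p m ^ 2) * w t - √(∑ m, p' m ^ 2) * w' t) ^ 2 := by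
  have hP0 : 0 ≤ ∑ m, p m ^ 2 := Finset.sum_nonneg fun _ _ => sq_nonneg _
  have hP0' : 0 ≤ ∑ m, p' m ^ 2 := Finset.sum_nonneg fun _ _ => sq_nonneg _
  have hP := Real.sq_sqrt hP0
  have hP' := Real.sq_sqrt hP0'
  have hk : ∑ m, p m * p' m ≤ √(∑ m, p m ^ 2) * √(∑ m, p' m ^ 2) :=
    Real.sum_mul_le_sqrt_mul_sqrt _ _ _
  have hl : ∑ t, w t * w' t ≤ R ^ 2 := by
    have h2 : 2 * ∑ t, w t * w' t ≤ ∑ t, w t ^ 2 + ∑ t, w' t ^ 2 := by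
      rw [Finset.mul_sum, ← Finset.sum_add_distrib]
      exact Finset.sum_le_sum fun t _ => by nlinarith [sq_nonneg (w t - w' t)]
    linarith
  set r := √(∑ m, p m ^ 2)
  set r' := √(∑ m, p' m ^ 2)
  have e1 : ∑ t, ∑ m, (w t * p m - w' t * p' m) ^ 2
      = (∑ t, w t ^ 2) * r ^ 2 + (∑ t, w' t ^ 2) * r' ^ 2
        - 2 * (∑ t, w t * w' t) * ∑ m, p m * p' m := by
    rw [hP, hP', mul_assoc, Finset.sum_mul_sum, Finset.sum_mul_sum, Finset.sum_mul_sum,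
      Finset.mul_sum, ← Finset.sum_add_distrib, ← Finset.sum_sub_distrib]
    refine Finset.sum_congr rfl fun t _ => ?_
    rw [Finset.mul_sum, ← Finset.sum_add_distrib, ← Finset.sum_sub_distrib]
    exact Finset.sum_congr rfl fun m _ => by ring
  have e2 : ∑ m, (p m - p' m) ^ 2 = r ^ 2 + r' ^ 2 - 2 * ∑ m, p m * p' m := by
    rw [hP, hP', Finset.mul_sum, ← Finset.sum_add_distrib, ← Finset.sum_sub_distrib]
    exact Finset.sum_congr rfl fun m _ => by ring
  have e3 : ∑ t, (r * w t - r' * w' t) ^ 2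
      = r ^ 2 * ∑ t, w t ^ 2 + r' ^ 2 * ∑ t, w' t ^ 2 - 2 * r * r' * ∑ t, w t * w' t := by
    rw [Finset.mul_sum, Finset.mul_sum, Finset.mul_sum, ← Finset.sum_add_distrib,
      ← Finset.sum_sub_distrib]
    exact Finset.sum_congr rfl fun t _ => by ring
  rw [e1, e2, e3]
  nlinarith [mul_nonneg (sub_nonneg.2 hl) (sub_nonneg.2 hk), mul_nonneg (sq_nonneg R)
    (sq_nonneg (r - r'))]

variable {H : Type*} [NormedAddCommGroup H] [InnerProductSpace ℝ H]

/-- On a finite-dimensional subspace the quadratic form of a positive operator is a sum of squares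
of functionals; the representing vectors are multiples of eigenvectors of the compression. -/
lemma exists_finite_factorization (Γ : H →L[ℝ] H) (hsym : ∀ u v, ⟪u, Γ v⟫ = ⟪v, Γ u⟫)
    (hpos : ∀ u, 0 ≤ ⟪u, Γ u⟫) {T : ℝ}
    (hT : ∀ (d : ℕ) (e : Fin d → H), Orthonormal ℝ e → ∑ k, ⟪e k, Γ (e k)⟫ ≤ T)
    (V : Submodule ℝ H) [FiniteDimensional ℝ V] :
    ∃ (d : ℕ) (q : Fin d → H), (∀ v ∈ V, ⟪v, Γ v⟫ = ∑ m, ⟪q m, v⟫ ^ 2) ∧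
      ∑ m, ‖q m‖ ^ 2 ≤ T ∧ ∀ v, ∑ m, ⟪q m, v⟫ ^ 2 ≤ ‖Γ‖ * ‖v‖ ^ 2 := by
  let A : V →ₗ[ℝ] V := (V.orthogonalProjectionOnto.comp (Γ.comp V.subtypeL) : V →L[ℝ] V)
  have hA : ∀ u v : V, ⟪u, A v⟫ = ⟪(u : H), Γ v⟫ := fun u v =>
    Submodule.inner_orthogonalProjectionOnto_eq_of_mem_left u (Γ v)
  have hAs : A.IsSymmetric := fun u v => by
    rw [real_inner_comm, hA, hA, hsym]
  let b := hAs.eigenvectorBasis rfl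
  let lam := hAs.eigenvalues rfl
  have hb : ∀ m, A (b m) = lam m • b m := fun m => by
    exact hAs.apply_eigenvectorBasis rfl m
  have hlam : ∀ m, lam m = ⟪(b m : H), Γ (b m)⟫ := fun m => by
    rw [← hA, hb, real_inner_smul_right, real_inner_self_eq_norm_sq, b.orthonormal.1 m]
    simp
  have hlam0 : ∀ m, 0 ≤ lam m := fun m => by rw [hlam]; exact hpos _
  have hbo : Orthonormal ℝ fun m => (b m : H) :=
    b.orthonormal.comp_linearIsometry V.subtypeₗᵢ
  have hlamB : ∀ m, lam m ≤ ‖Γ‖ := fun m => by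
    rw [hlam]
    refine (real_inner_le_norm _ _).trans ?_
    have h1 : ‖(b m : H)‖ = 1 := hbo.1 m
    simpa [h1] using Γ.le_opNorm (b m : H)
  have hq : ∀ m v, ⟪√(lam m) • (b m : H), v⟫ ^ 2 = lam m * ⟪(b m : H), v⟫ ^ 2 := fun m v => by
    rw [real_inner_smul_left, mul_pow, Real.sq_sqrt (hlam0 m)]
  refine ⟨_, fun m => √(lam m) • (b m : H), fun v hv => ?_, ?_, fun v => ?_⟩
  · simp_rw [hq]
    have h1 := (b.sum_inner_mul_inner (⟨v, hv⟩ : V) (A ⟨v, hv⟩)).symm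
    rw [hA] at h1
    change ⟪v, Γ v⟫ = _ at h1
    rw [h1]
    refine Finset.sum_congr rfl fun m _ => ?_
    rw [← hAs, hb, real_inner_smul_left, real_inner_comm]
    change ⟪(b m : H), v⟫ * (lam m * ⟪(b m : H), v⟫) = _
    ring
  · have : ∀ m, ‖√(lam m) • (b m : H)‖ ^ 2 = ⟪(b m : H), Γ (b m)⟫ := fun m => by
      rw [norm_smul, mul_pow, Real.norm_eq_abs, sq_abs, Real.sq_sqrt (hlam0 m), hbo.1 m, ← hlam]
      simp
    simp_rw [this]
    exact hT _ _ hbo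
  · simp_rw [hq]
    calc ∑ m, lam m * ⟪(b m : H), v⟫ ^ 2 ≤ ∑ m, ‖Γ‖ * ⟪(b m : H), v⟫ ^ 2 :=
          Finset.sum_le_sum fun m _ => mul_le_mul_of_nonneg_right (hlamB m) (sq_nonneg _)
      _ ≤ ‖Γ‖ * ‖v‖ ^ 2 := by
          rw [← Finset.mul_sum]
          refine mul_le_mul_of_nonneg_left ?_ (norm_nonneg _)
          simpa using hbo.sum_inner_products_le v (s := Finset.univ)

lemma integral_le_sqrt_integral_sq {Ω : Type*} [MeasurableSpace Ω] {μ : Measure Ω}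
    [IsProbabilityMeasure μ] {f : Ω → ℝ} (hf : MemLp f 2 μ) :
    ∫ ω, f ω ∂μ ≤ √(∫ ω, f ω ^ 2 ∂μ) := by
  refine Real.le_sqrt_of_sq_le ?_
  have h := variance_eq_sub hf
  have h0 := variance_nonneg f μ
  rw [h] at h0
  simpa using sub_nonneg.1 h0

section StandardGaussian

variable {M : Type*} [Fintype M]

lemma integral_apply_mul_apply_stdGaussian [DecidableEq M] (i j : M) :
    ∫ y, y i * y j ∂(stdGaussian (EuclideanSpace ℝ M)) = if i = j then 1 else 0 := by
  have h := covarianceBilin_apply (μ := stdGaussian (EuclideanSpace ℝ M)) IsGaussian.memLp_two_id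
    (EuclideanSpace.single i 1) (EuclideanSpace.single j 1)
  rw [covarianceBilin_stdGaussian] at h
  change ⟪EuclideanSpace.single i (1 : ℝ), EuclideanSpace.single j (1 : ℝ)⟫ = _ at h
  rw [EuclideanSpace.inner_single_left] at h
  simp [EuclideanSpace.inner_single_left] at h
  exact h.symm

lemma memLp_apply_stdGaussian (i : M) :
    MemLp (fun y : EuclideanSpace ℝ M => y i) 2 (stdGaussian (EuclideanSpace ℝ M)) :=
  IsGaussian.memLp_dual _ (EuclideanSpace.proj i : StrongDual ℝ (EuclideanSpace ℝ M)) 2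
    (by norm_num)

lemma memLp_sum_smul_stdGaussian (q : M → H) :
    MemLp (fun y : EuclideanSpace ℝ M => ∑ m, y m • q m) 2 (stdGaussian (EuclideanSpace ℝ M)) :=
  memLp_finsetSum _ fun m _ =>
    (ContinuousLinearMap.toSpanSingleton ℝ (q m)).comp_memLp' (memLp_apply_stdGaussian m)

lemma integral_norm_sum_smul_sq_stdGaussian (q : M → H) :
    ∫ y, ‖∑ m, y m • q m‖ ^ 2 ∂(stdGaussian (EuclideanSpace ℝ M)) = ∑ m, ‖q m‖ ^ 2 := by
  classical
  have e : ∀ y : EuclideanSpace ℝ M, ‖∑ m, y m • q m‖ ^ 2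
      = ∑ m, ∑ l, y m * y l * ⟪q m, q l⟫ := fun y => by
    rw [← real_inner_self_eq_norm_sq, sum_inner]
    refine Finset.sum_congr rfl fun m _ => ?_
    rw [inner_sum]
    refine Finset.sum_congr rfl fun l _ => ?_
    rw [real_inner_smul_left, real_inner_smul_right, mul_assoc]
  have hi : ∀ m l : M, Integrable (fun y : EuclideanSpace ℝ M => y m * y l * ⟪q m, q l⟫)
      (stdGaussian (EuclideanSpace ℝ M)) := fun m l =>
    ((memLp_apply_stdGaussian m).integrable_mul (memLp_apply_stdGaussian l)).mul_const _
  simp_rw [e]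
  rw [integral_finsetSum _ fun m _ => integrable_finsetSum _ fun l _ => hi m l]
  refine Finset.sum_congr rfl fun m _ => ?_
  rw [integral_finsetSum _ fun l _ => hi m l]
  simp_rw [integral_mul_const, integral_apply_mul_apply_stdGaussian]
  simp

lemma integral_sum_mul_sq_stdGaussian (c : M → ℝ) :
    ∫ y, (∑ m, y m * c m) ^ 2 ∂(stdGaussian (EuclideanSpace ℝ M)) = ∑ m, c m ^ 2 := by
  simpa using integral_norm_sum_smul_sq_stdGaussian c

lemma integral_sum_mul_stdGaussian (c : M → ℝ) :
    ∫ y, ∑ m, y m * c m ∂(stdGaussian (EuclideanSpace ℝ M)) = 0 := by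
  have h := integral_strongDual_stdGaussian (E := EuclideanSpace ℝ M)
    (∑ m, c m • (EuclideanSpace.proj m : StrongDual ℝ (EuclideanSpace ℝ M)))
  rw [← h]
  refine integral_congr_ae (.of_forall fun y => ?_)
  simp [mul_comm]

end StandardGaussian

end Chevet

section ChevetBound

lemma integral_add_sq_stdGaussian_prod {M I : Type*} [Fintype M] [Fintype I] (c : M → ℝ)
    (c' : I → ℝ) :
    ∫ y : EuclideanSpace ℝ M × EuclideanSpace ℝ I, (∑ m, y.1 m * c m + ∑ t, y.2 t * c' t) ^ 2
      ∂((stdGaussian _).prod (stdGaussian _)) = ∑ m, c m ^ 2 + ∑ t, c' t ^ 2 := by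
  have h1 : MemLp (fun y : EuclideanSpace ℝ M => ∑ m, y m * c m) 2 (stdGaussian _) :=
    memLp_sum_smul_stdGaussian c
  have h2 : MemLp (fun y : EuclideanSpace ℝ I => ∑ t, y t * c' t) 2 (stdGaussian _) :=
    memLp_sum_smul_stdGaussian c'
  have e : ∀ y : EuclideanSpace ℝ M × EuclideanSpace ℝ I,
      (∑ m, y.1 m * c m + ∑ t, y.2 t * c' t) ^ 2 = ((∑ m, y.1 m * c m) ^ 2
        + (∑ t, y.2 t * c' t) ^ 2) + 2 * ((∑ m, y.1 m * c m) * ∑ t, y.2 t * c' t) :=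
    fun y => by ring
  simp_rw [e]
  have i1 := h1.integrable_sq.comp_fst (stdGaussian (EuclideanSpace ℝ I))
  have i2 := h2.integrable_sq.comp_snd (stdGaussian (EuclideanSpace ℝ M))
  rw [integral_add (by exact i1.add i2)
    (((h1.integrable (by norm_num)).mul_prod (h2.integrable (by norm_num))).const_mul 2),
    integral_add i1 i2, integral_const_mul,
    integral_prod_mul (fun y : EuclideanSpace ℝ M => ∑ m, y m * c m)
      (fun y : EuclideanSpace ℝ I => ∑ t, y t * c' t),
    integral_fun_fst (fun y : EuclideanSpace ℝ M => (∑ m, y m * c m) ^ 2),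
    integral_fun_snd (fun y : EuclideanSpace ℝ I => (∑ t, y t * c' t) ^ 2),
    integral_sum_mul_stdGaussian, integral_sum_mul_sq_stdGaussian, integral_sum_mul_sq_stdGaussian]
  simp

variable {H : Type*} [NormedAddCommGroup H] [InnerProductSpace ℝ H]
  {E : Type*} [NormedAddCommGroup E] [NormedSpace ℝ E] [CompleteSpace E]
  [SecondCountableTopology E] [MeasurableSpace E] [BorelSpace E]

/-- A Chevet-type inequality. Let `Z u = (⟪z t, u⟫)_t`. If the increments of a Gaussian family `ξ j`
are dominated by those of `⟪G, s j Z (u j) ⊗ Γ ^ (1/2) (u j)⟫`, where `G` is a standard Gaussian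
matrix, then the expected maximum is bounded in terms of the trace and the norm of `Γ`. Since the
same vector `u j` enters both factors, the two terms of Chevet's inequality add up in quadrature,
up to a mixed term of size `R * ‖Γ‖ * ‖z‖`. -/
theorem integral_sup'_le_of_increments_le {μ : Measure E} [IsGaussian μ] (hμ : μ[id] = 0)
    {J I : Type*} [Fintype J] [Nonempty J] [Fintype I]
    (Γ : H →L[ℝ] H) (hsym : ∀ u v, ⟪u, Γ v⟫ = ⟪v, Γ u⟫) (hpos : ∀ u, 0 ≤ ⟪u, Γ u⟫) {T : ℝ}
    (hT : ∀ (d : ℕ) (e : Fin d → H), Orthonormal ℝ e → ∑ k, ⟪e k, Γ (e k)⟫ ≤ T)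
    (u : J → H) (hu : ∀ j, ‖u j‖ ≤ 1) (s : J → ℝ) (hs : ∀ j, |s j| ≤ 1) (z : I → H) {R : ℝ}
    (hR : 0 ≤ R) (hz : ∀ j, ∑ t, ⟪z t, u j⟫ ^ 2 ≤ R ^ 2) (ξ : J → StrongDual ℝ E)
    (hξ : ∀ j k, ∫ ω, (ξ j ω - ξ k ω) ^ 2 ∂μ ≤
      ∑ t, ⟪(s j * ⟪z t, u j⟫) • u j - (s k * ⟪z t, u k⟫) • u k,
        Γ ((s j * ⟪z t, u j⟫) • u j - (s k * ⟪z t, u k⟫) • u k)⟫) :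
    ∫ ω, Finset.univ.sup' Finset.univ_nonempty (fun j => ξ j ω) ∂μ ≤
      √(R ^ 2 * T + ‖Γ‖ * ∑ t, ‖z t‖ ^ 2 + 2 * R * ‖Γ‖ * √(∑ t, ‖z t‖ ^ 2)) := by
  have : FiniteDimensional ℝ (Submodule.span ℝ (Set.range u)) :=
    FiniteDimensional.span_of_finite ℝ (Set.finite_range u)
  obtain ⟨d, q, hq, hqT, hqB⟩ := exists_finite_factorization Γ hsym hpos hT
    (Submodule.span ℝ (Set.range u))
  have hmem : ∀ j, u j ∈ Submodule.span ℝ (Set.range u) := fun j =>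
    Submodule.subset_span (Set.mem_range_self j)
  let p : J → Fin d → ℝ := fun j m => ⟪q m, u j⟫
  let w : J → I → ℝ := fun j t => s j * ⟪z t, u j⟫
  let ρ : J → ℝ := fun j => √(∑ m, p j m ^ 2)
  have hw : ∀ j, ∑ t, w j t ^ 2 ≤ R ^ 2 := fun j => by
    refine (Finset.sum_le_sum fun t _ => ?_).trans (hz j)
    simp only [w, mul_pow]
    exact mul_le_of_le_one_left (sq_nonneg _) ((sq_le_one_iff_abs_le_one _).2 (hs j))
  have hρ : ∀ j, ρ j ≤ √‖Γ‖ := fun j => by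
    refine Real.sqrt_le_sqrt ((hqB (u j)).trans ?_)
    exact mul_le_of_le_one_right (norm_nonneg _) (pow_le_one₀ (norm_nonneg _) (hu j))
  let ν : Measure (EuclideanSpace ℝ (Fin d) × EuclideanSpace ℝ I) :=
    (stdGaussian _).prod (stdGaussian _)
  have hν : ν[id] = 0 := integral_id_prod_eq_zero (by simp) (by simp)
  let M : J → StrongDual ℝ (EuclideanSpace ℝ (Fin d) × EuclideanSpace ℝ I) := fun j =>
    (∑ m, (R * p j m) • (EuclideanSpace.proj m : StrongDual ℝ (EuclideanSpace ℝ (Fin d)))).comp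
        (ContinuousLinearMap.fst ℝ _ _) +
      (∑ t, (ρ j * w j t) • (EuclideanSpace.proj t : StrongDual ℝ (EuclideanSpace ℝ I))).comp
        (ContinuousLinearMap.snd ℝ _ _)
  have hM : ∀ j (y : EuclideanSpace ℝ (Fin d) × EuclideanSpace ℝ I), M j y =
      ∑ m, y.1 m * (R * p j m) + ∑ t, y.2 t * (ρ j * w j t) :=
    fun j y => by simp [M, mul_comm]
  have hincr : ∀ j k, ∫ ω, (ξ j ω - ξ k ω) ^ 2 ∂μ ≤ ∫ y, (M j y - M k y) ^ 2 ∂ν := fun j k => by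
    have e : ∀ y : EuclideanSpace ℝ (Fin d) × EuclideanSpace ℝ I, (M j y - M k y) ^ 2 =
        (∑ m, y.1 m * (R * p j m - R * p k m) +
          ∑ t, y.2 t * (ρ j * w j t - ρ k * w k t)) ^ 2 := fun y => by
      simp only [hM, mul_sub, Finset.sum_sub_distrib]
      ring
    simp_rw [e]
    rw [integral_add_sq_stdGaussian_prod]
    refine (hξ j k).trans ?_
    have e1 : ∀ t, ⟪(s j * ⟪z t, u j⟫) • u j - (s k * ⟪z t, u k⟫) • u k,
        Γ ((s j * ⟪z t, u j⟫) • u j - (s k * ⟪z t, u k⟫) • u k)⟫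
        = ∑ m, (w j t * p j m - w k t * p k m) ^ 2 := fun t => by
      rw [hq _ (Submodule.sub_mem _ (Submodule.smul_mem _ _ (hmem j))
        (Submodule.smul_mem _ _ (hmem k)))]
      refine Finset.sum_congr rfl fun m _ => ?_
      rw [inner_sub_right, real_inner_smul_right, real_inner_smul_right]
    simp_rw [e1, ← mul_sub, mul_pow, ← Finset.mul_sum]
    exact sum_sum_sub_sq_le (p j) (p k) (w j) (w k) (hw j) (hw k)
  refine (sudakov_fernique hμ hν ξ M hincr).trans ?_
  -- `M j` is the inner product of `u j`, of norm at most one, with `α + (s j * ρ j) • β`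
  let α : EuclideanSpace ℝ (Fin d) → H := fun y => ∑ m, y m • (R • q m)
  let β : EuclideanSpace ℝ I → H := fun y => ∑ t, y t • z t
  let Ψ : EuclideanSpace ℝ (Fin d) × EuclideanSpace ℝ I → ℝ := fun y =>
    ‖α y.1‖ ^ 2 + ‖Γ‖ * ‖β y.2‖ ^ 2 + 2 * √‖Γ‖ * |⟪α y.1, β y.2⟫|
  have hB := Real.sq_sqrt (norm_nonneg Γ)
  have hΨ0 : ∀ y, 0 ≤ Ψ y := fun y => by positivity
  have hsup : ∀ y, Finset.univ.sup' Finset.univ_nonempty (fun j => M j y) ≤ √(Ψ y) := fun y => by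
    refine Finset.sup'_le _ _ fun j _ => ?_
    set c : ℝ := s j * ρ j
    have hc : |c| ≤ √‖Γ‖ := by
      rw [abs_mul, abs_of_nonneg (Real.sqrt_nonneg _ : 0 ≤ ρ j)]
      exact (mul_le_of_le_one_left (Real.sqrt_nonneg _) (hs j)).trans (hρ j)
    have e : M j y = ⟪α y.1 + c • β y.2, u j⟫ := by
      rw [hM, inner_add_left, real_inner_smul_left, sum_inner, sum_inner, Finset.mul_sum]
      congr 1
      · exact Finset.sum_congr rfl fun m _ => by
          rw [real_inner_smul_left, real_inner_smul_left]
      · exact Finset.sum_congr rfl fun t _ => by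
          rw [real_inner_smul_left]; simp only [w, c]; ring
    rw [e]
    refine Real.le_sqrt_of_sq_le ?_
    have h1 : ⟪α y.1 + c • β y.2, u j⟫ ^ 2 ≤ ‖α y.1 + c • β y.2‖ ^ 2 := by
      rw [← sq_abs]
      refine pow_le_pow_left₀ (abs_nonneg _) ((abs_real_inner_le_norm _ _).trans ?_) 2
      exact mul_le_of_le_one_right (norm_nonneg _) (hu j)
    refine h1.trans ?_
    rw [norm_add_sq_real, real_inner_smul_right, norm_smul, mul_pow, Real.norm_eq_abs]
    have h2 : |c| ^ 2 * ‖β y.2‖ ^ 2 ≤ ‖Γ‖ * ‖β y.2‖ ^ 2 := by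
      rw [← hB]; gcongr
    have h3 : c * ⟪α y.1, β y.2⟫ ≤ √‖Γ‖ * |⟪α y.1, β y.2⟫| := by
      refine (le_abs_self _).trans ?_
      rw [abs_mul]; gcongr
    simp only [Ψ]
    linarith
  have mα : MemLp α 2 (stdGaussian _) := memLp_sum_smul_stdGaussian _
  have mβ : MemLp β 2 (stdGaussian _) := memLp_sum_smul_stdGaussian _
  have iα := mα.norm.integrable_sq.comp_fst (stdGaussian (EuclideanSpace ℝ I))
  have iβ := mβ.norm.integrable_sq.comp_snd (stdGaussian (EuclideanSpace ℝ (Fin d)))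
  have iαβ : Integrable (fun y : EuclideanSpace ℝ (Fin d) × EuclideanSpace ℝ I =>
      |⟪α y.1, β y.2⟫|) ν := by
    refine Integrable.mono' (((mα.norm.integrable (by norm_num)).mul_prod
      (mβ.norm.integrable (by norm_num)))) (Continuous.aestronglyMeasurable (by fun_prop))
      (.of_forall fun y => ?_)
    rw [Real.norm_eq_abs, abs_abs]
    exact abs_real_inner_le_norm _ _
  have hcross : ∫ y, |⟪α y.1, β y.2⟫| ∂ν ≤ R * √‖Γ‖ * √(∑ t, ‖z t‖ ^ 2) := by
    have hin : ∀ v : H, ∫ y, |⟪α y, v⟫| ∂(stdGaussian _) ≤ R * √‖Γ‖ * ‖v‖ := fun v => by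
      have hm : MemLp (fun y => ⟪α y, v⟫) 2 (stdGaussian _) := mα.inner_const v
      have hm' : MemLp (fun y => |⟪α y, v⟫|) 2 (stdGaussian _) := hm.abs
      refine (integral_le_sqrt_integral_sq hm').trans ?_
      have e : ∀ y, |⟪α y, v⟫| ^ 2 = (∑ m, y m * (R * ⟪q m, v⟫)) ^ 2 := fun y => by
        rw [sq_abs, sum_inner]
        simp_rw [real_inner_smul_left]
      simp_rw [e]
      rw [integral_sum_mul_sq_stdGaussian]
      refine Real.sqrt_le_iff.2 ⟨by positivity, ?_⟩
      simp_rw [mul_pow]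
      rw [← Finset.mul_sum, mul_assoc, hB]
      exact mul_le_mul_of_nonneg_left (hqB v) (sq_nonneg _)
    rw [integral_prod_symm _ iαβ]
    have hβ1 : ∫ y, ‖β y‖ ∂(stdGaussian _) ≤ √(∑ t, ‖z t‖ ^ 2) := by
      refine (integral_le_sqrt_integral_sq mβ.norm).trans_eq ?_
      rw [integral_norm_sum_smul_sq_stdGaussian]
    calc _ ≤ ∫ y, R * √‖Γ‖ * ‖β y‖ ∂(stdGaussian _) :=
          integral_mono iαβ.integral_prod_right ((mβ.norm.integrable (by norm_num)).const_mul _)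
            fun y => hin (β y)
      _ ≤ _ := by
        rw [integral_const_mul]
        exact mul_le_mul_of_nonneg_left hβ1 (by positivity)
  have iΨ : Integrable Ψ ν := (iα.add (iβ.const_mul _)).add (iαβ.const_mul _)
  have mΨ : MemLp (fun y => √(Ψ y)) 2 ν := by
    rw [memLp_two_iff_integrable_sq
      (Real.continuous_sqrt.comp_aestronglyMeasurable iΨ.aestronglyMeasurable)]
    simpa only [Real.sq_sqrt (hΨ0 _)] using iΨ
  calc ∫ y, Finset.univ.sup' Finset.univ_nonempty (fun j => M j y) ∂ν
      ≤ ∫ y, √(Ψ y) ∂ν :=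
        integral_mono (integrable_sup' ν M) (mΨ.integrable (by norm_num)) hsup
    _ ≤ √(∫ y, Ψ y ∂ν) := by
        refine (integral_le_sqrt_integral_sq mΨ).trans_eq ?_
        simp_rw [Real.sq_sqrt (hΨ0 _)]
    _ ≤ _ := by
        refine Real.sqrt_le_sqrt ?_
        simp only [Ψ]
        rw [integral_add (by exact iα.add (iβ.const_mul _)) (iαβ.const_mul _),
          integral_add iα (iβ.const_mul _), integral_const_mul, integral_const_mul,
          integral_fun_fst (fun y => ‖α y‖ ^ 2), integral_fun_snd (fun y => ‖β y‖ ^ 2),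
          integral_norm_sum_smul_sq_stdGaussian, integral_norm_sum_smul_sq_stdGaussian]
        have h1 : ∑ m, ‖R • q m‖ ^ 2 ≤ R ^ 2 * T := by
          simp_rw [norm_smul, mul_pow, Real.norm_eq_abs, sq_abs]
          rw [← Finset.mul_sum]
          exact mul_le_mul_of_nonneg_left hqT (sq_nonneg _)
        have h2 : 2 * √‖Γ‖ * ∫ y, |⟪α y.1, β y.2⟫| ∂ν ≤ 2 * R * ‖Γ‖ * √(∑ t, ‖z t‖ ^ 2) := by
          refine (mul_le_mul_of_nonneg_left hcross (by positivity)).trans_eq ?_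
          linear_combination (2 * R * √(∑ t, ‖z t‖ ^ 2)) * hB
        simp only [probReal_univ, one_smul]
        linarith

end ChevetBound

/-! ### Decoupling -/

section OperatorNorm

variable {H : Type*} [NormedAddCommGroup H] [InnerProductSpace ℝ H]

lemma norm_le_of_forall_abs_inner_le {S : H →L[ℝ] H} (hS : ∀ u v, ⟪u, S v⟫ = ⟪v, S u⟫) {c : ℝ}
    (hc : 0 ≤ c) (h : ∀ u, ‖u‖ ≤ 1 → |⟪u, S u⟫| ≤ c) : ‖S‖ ≤ c := by
  have hsymm : (S : H →ₗ[ℝ] H).IsSymmetric := fun u v => by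
    change ⟪S u, v⟫ = ⟪u, S v⟫
    rw [real_inner_comm, hS]
  rw [ContinuousLinearMap.norm_eq_iSup_rayleighQuotient S hsymm]
  refine Real.iSup_le (fun u => ?_) hc
  by_cases hu : u = 0
  · subst hu
    simpa [ContinuousLinearMap.rayleighQuotient] using hc
  have hn : ‖u‖ ≠ 0 := norm_ne_zero_iff.2 hu
  have h1 := h (‖u‖⁻¹ • u) (by rw [norm_smul, norm_inv, norm_norm, inv_mul_cancel₀ hn])
  have e : S.rayleighQuotient u = ⟪‖u‖⁻¹ • u, S (‖u‖⁻¹ • u)⟫ := by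
    rw [map_smul, real_inner_smul_left, real_inner_smul_right, real_inner_comm]
    change ⟪S u, u⟫ / ‖u‖ ^ 2 = _
    field_simp
  rwa [e]

/-- The norm of a symmetric operator is the limit of the maxima of its quadratic form over the
initial segments of a dense sequence in the unit ball. -/
lemma tendsto_sup'_abs_inner {S : H →L[ℝ] H} (hS : ∀ u v, ⟪u, S v⟫ = ⟪v, S u⟫) {v : ℕ → H}
    (hv1 : ∀ k, ‖v k‖ ≤ 1) (hv : ∀ u, ‖u‖ ≤ 1 → u ∈ closure (Set.range v)) :
    Filter.Tendsto (fun N : ℕ => Finset.univ.sup' Finset.univ_nonempty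
      (fun j : Fin (N + 1) => |⟪v j, S (v j)⟫|)) Filter.atTop (nhds ‖S‖) := by
  refine tendsto_atTop_isLUB (fun N M hNM => ?_) ⟨?_, fun c hc => ?_⟩
  · refine Finset.sup'_le _ _ fun j _ => ?_
    exact Finset.le_sup' (fun j : Fin (M + 1) => |⟪v j, S (v j)⟫|)
      (Finset.mem_univ (Fin.castLE (by omega) j))
  · rintro _ ⟨N, rfl⟩
    refine Finset.sup'_le _ _ fun j _ => (abs_real_inner_le_norm _ _).trans ?_
    calc ‖v j‖ * ‖S (v j)‖ ≤ 1 * (‖S‖ * 1) :=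
          mul_le_mul (hv1 _) ((S.le_opNorm _).trans
            (mul_le_mul_of_nonneg_left (hv1 _) (norm_nonneg _))) (norm_nonneg _) zero_le_one
      _ = ‖S‖ := by ring
  · have hk : ∀ k, |⟪v k, S (v k)⟫| ≤ c := fun k =>
      (Finset.le_sup' (fun j : Fin (k + 1) => |⟪v j, S (v j)⟫|)
        (Finset.mem_univ (Fin.last k))).trans (hc (Set.mem_range_self k))
    refine norm_le_of_forall_abs_inner_le hS ((abs_nonneg _).trans (hk 0)) fun u hu => ?_
    have hcl : IsClosed {u : H | |⟪u, S u⟫| ≤ c} := isClosed_le (by fun_prop) continuous_const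
    exact closure_minimal (by rintro _ ⟨k, rfl⟩; exact hk k) hcl (hv u hu)

lemma exists_dense_seq_unit_ball [SecondCountableTopology H] :
    ∃ v : ℕ → H, (∀ k, ‖v k‖ ≤ 1) ∧ ∀ u, ‖u‖ ≤ 1 → u ∈ closure (Set.range v) := by
  have : Nonempty (Metric.closedBall (0 : H) 1) := ⟨⟨0, by simp⟩⟩
  obtain ⟨w, hw⟩ := TopologicalSpace.exists_dense_seq (Metric.closedBall (0 : H) 1)
  refine ⟨fun k => w k, fun k => mem_closedBall_zero_iff.1 (w k).2, fun u hu => ?_⟩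
  have h := hw ⟨u, by simpa using hu⟩
  have h2 := image_closure_subset_closure_image continuous_subtype_val (Set.mem_image_of_mem _ h)
  rwa [← Set.range_comp] at h2

end OperatorNorm

lemma integral_sqrt_mul_sqrt_le {Ω : Type*} [MeasurableSpace Ω] {μ : Measure Ω} {f g : Ω → ℝ}
    (hf0 : ∀ ω, 0 ≤ f ω) (hg0 : ∀ ω, 0 ≤ g ω) (hf : Integrable f μ) (hg : Integrable g μ) :
    ∫ ω, √(f ω) * √(g ω) ∂μ ≤ √(∫ ω, f ω ∂μ) * √(∫ ω, g ω ∂μ) := by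
  have m : ∀ {f : Ω → ℝ}, (∀ ω, 0 ≤ f ω) → Integrable f μ →
      MemLp (fun ω => √(f ω)) (ENNReal.ofReal 2) μ := fun {f} h0 hi => by
    rw [show ENNReal.ofReal 2 = 2 by simp, memLp_two_iff_integrable_sq
      (Real.continuous_sqrt.comp_aestronglyMeasurable hi.aestronglyMeasurable)]
    simpa only [Real.sq_sqrt (h0 _)] using hi
  have h := integral_mul_le_Lp_mul_Lq_of_nonneg (μ := μ) (p := 2) (q := 2)
    Real.HolderConjugate.two_two (.of_forall fun ω => Real.sqrt_nonneg (f ω))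
    (.of_forall fun ω => Real.sqrt_nonneg (g ω)) (m hf0 hf) (m hg0 hg)
  simp only [Real.rpow_two, Real.sq_sqrt (hf0 _), Real.sq_sqrt (hg0 _)] at h
  rwa [← Real.sqrt_eq_rpow, ← Real.sqrt_eq_rpow] at h

section Decoupling

variable {H : Type*} [NormedAddCommGroup H] [InnerProductSpace ℝ H] [CompleteSpace H]
  [SecondCountableTopology H] [MeasurableSpace H] [BorelSpace H] {I : Type*} [Fintype I]

/-- The operator `∑ t, z t ⊗ z t`. -/
noncomputable def gram (z : I → H) : H →L[ℝ] H :=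
  ∑ t, InnerProductSpace.rankOne ℝ (z t) (z t)

/-- The polarization `∑ t, (z t ⊗ z' t + z' t ⊗ z t)` of `gram`. -/
noncomputable def crossGram (z z' : I → H) : H →L[ℝ] H :=
  ∑ t, (InnerProductSpace.rankOne ℝ (z t) (z' t) + InnerProductSpace.rankOne ℝ (z' t) (z t))

lemma continuous_gram : Continuous (gram : (I → H) → H →L[ℝ] H) := by
  have h : ∀ t, Continuous fun z : I → H => (z t, z t) := fun t => by fun_prop
  change Continuous fun z : I → H => ∑ t, InnerProductSpace.rankOne ℝ (z t) (z t)
  exact continuous_finsetSum _ fun t _ => continuous_rankOne.comp (h t)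

lemma continuous_crossGram : Continuous fun p : (I → H) × (I → H) => crossGram p.1 p.2 := by
  have h : ∀ t, Continuous fun p : (I → H) × (I → H) => (p.1 t, p.2 t) := fun t => by fun_prop
  have h' : ∀ t, Continuous fun p : (I → H) × (I → H) => (p.2 t, p.1 t) := fun t => by fun_prop
  exact continuous_finsetSum _ fun t _ =>
    (continuous_rankOne.comp (h t)).add (continuous_rankOne.comp (h' t))

lemma inner_gram_self (z : I → H) (u : H) : ⟪u, gram z u⟫ = ∑ t, ⟪z t, u⟫ ^ 2 := by
  rw [gram, sum_apply, inner_sum]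
  refine Finset.sum_congr rfl fun t _ => ?_
  rw [InnerProductSpace.rankOne_apply, real_inner_smul_right, real_inner_comm, pow_two]

lemma inner_crossGram (z z' : I → H) (u v : H) :
    ⟪u, crossGram z z' v⟫ = ∑ t, (⟪z t, u⟫ * ⟪z' t, v⟫ + ⟪z' t, u⟫ * ⟪z t, v⟫) := by
  rw [crossGram, sum_apply, inner_sum]
  refine Finset.sum_congr rfl fun t _ => ?_
  rw [add_apply, inner_add_right, InnerProductSpace.rankOne_apply, InnerProductSpace.rankOne_apply,
    real_inner_smul_right, real_inner_smul_right, real_inner_comm (z t) u,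
    real_inner_comm (z' t) u]
  ring

lemma inner_crossGram_comm (z z' : I → H) (u v : H) :
    ⟪u, crossGram z z' v⟫ = ⟪v, crossGram z z' u⟫ := by
  rw [inner_crossGram, inner_crossGram]
  exact Finset.sum_congr rfl fun t _ => by ring

lemma inner_crossGram_self (z z' : I → H) (u : H) :
    ⟪u, crossGram z z' u⟫ = 2 * ∑ t, ⟪z' t, u⟫ * ⟪z t, u⟫ := by
  rw [inner_crossGram, Finset.mul_sum]
  exact Finset.sum_congr rfl fun t _ => by ring

lemma norm_gram_le (z : I → H) : ‖gram z‖ ≤ ∑ t, ‖z t‖ ^ 2 :=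
  (norm_sum_le _ _).trans_eq (Finset.sum_congr rfl fun t _ => by
    rw [InnerProductSpace.norm_rankOne, pow_two])

lemma norm_crossGram_le (z z' : I → H) : ‖crossGram z z'‖ ≤ 2 * ∑ t, ‖z t‖ * ‖z' t‖ := by
  rw [Finset.mul_sum]
  refine (norm_sum_le _ _).trans (Finset.sum_le_sum fun t _ => (norm_add_le _ _).trans_eq ?_)
  rw [InnerProductSpace.norm_rankOne, InnerProductSpace.norm_rankOne]
  ring

lemma gram_sub_gram_rotation (p : (I → H) × (I → H)) :
    gram (ContinuousLinearMap.rotation (Real.pi / 4) p).1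
      - gram (ContinuousLinearMap.rotation (Real.pi / 4) p).2 = crossGram p.1 p.2 := by
  have hs : (√2 / 2) * (√2 / 2) = (1 / 2 : ℝ) := by
    have := Real.mul_self_sqrt (show (0 : ℝ) ≤ 2 by norm_num)
    linarith
  rw [gram, gram, crossGram, ← Finset.sum_sub_distrib]
  refine Finset.sum_congr rfl fun t _ => ?_
  ext v
  simp only [ContinuousLinearMap.rotation_apply, Real.cos_pi_div_four, Real.sin_pi_div_four,
    Pi.add_apply, Pi.smul_apply, sub_apply, add_apply, InnerProductSpace.rankOne_apply,
    inner_add_left, real_inner_smul_left]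
  match_scalars
  · linear_combination (2 * ⟪p.2 t, v⟫) * hs
  · linear_combination (2 * ⟪p.1 t, v⟫) * hs

variable {μ : Measure (I → H)} [IsGaussian μ]

lemma memLp_eval_of_isGaussian (t : I) : MemLp (fun z : I → H => z t) 2 μ :=
  (ContinuousLinearMap.proj (R := ℝ) (φ := fun _ : I => H) t).comp_memLp'
    (IsGaussian.memLp_two_id (μ := μ))

lemma integrable_sum_norm_sq : Integrable (fun z : I → H => ∑ t, ‖z t‖ ^ 2) μ :=
  integrable_finsetSum _ fun t _ => (memLp_eval_of_isGaussian t).norm.integrable_sq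

lemma integrable_gram : Integrable (gram : (I → H) → H →L[ℝ] H) μ :=
  (integrable_sum_norm_sq (μ := μ)).mono' continuous_gram.stronglyMeasurable.aestronglyMeasurable
    (.of_forall norm_gram_le)

lemma integrable_crossGram :
    Integrable (fun p : (I → H) × (I → H) => crossGram p.1 p.2) (μ.prod μ) := by
  refine Integrable.mono' ((integrable_finsetSum Finset.univ fun t _ =>
    ((memLp_eval_of_isGaussian t).norm.integrable (by norm_num)).mul_prod
      ((memLp_eval_of_isGaussian t).norm.integrable (by norm_num))).const_mul 2)
    continuous_crossGram.stronglyMeasurable.aestronglyMeasurable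
    (.of_forall fun p => norm_crossGram_le p.1 p.2)

/-- Decoupling: subtract an independent copy of `gram z` by Jensen's inequality, and rotate the pair
of independent Gaussian vectors by `π / 4`. -/
theorem integral_norm_gram_sub_le (hμ : μ[id] = 0) :
    ∫ z, ‖gram z - ∫ z', gram z' ∂μ‖ ∂μ ≤ ∫ p, ‖crossGram p.1 p.2‖ ∂(μ.prod μ) := by
  have hi : Integrable (gram : (I → H) → H →L[ℝ] H) μ := integrable_gram
  have hint : Integrable (fun p : (I → H) × (I → H) => gram p.1 - gram p.2) (μ.prod μ) :=
    (hi.comp_fst μ).sub (hi.comp_snd μ)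
  calc ∫ z, ‖gram z - ∫ z', gram z' ∂μ‖ ∂μ
      ≤ ∫ z, ∫ z', ‖gram z - gram z'‖ ∂μ ∂μ := by
        refine integral_mono (hi.sub (integrable_const _)).norm hint.norm.integral_prod_left
          fun z => ?_
        have e : gram z - ∫ z', gram z' ∂μ = ∫ z', (gram z - gram z') ∂μ := by
          rw [integral_sub (integrable_const _) hi]; simp
        simp only [e]
        exact norm_integral_le_integral_norm _
    _ = ∫ p, ‖gram p.1 - gram p.2‖ ∂(μ.prod μ) := (integral_prod _ hint.norm).symm
    _ = ∫ p, ‖crossGram p.1 p.2‖ ∂(μ.prod μ) := by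
        have hc : Continuous fun p : (I → H) × (I → H) => ‖gram p.1 - gram p.2‖ :=
          ((continuous_gram.comp continuous_fst).sub (continuous_gram.comp continuous_snd)).norm
        conv_lhs => rw [← IsGaussian.map_rotation_eq_self hμ (Real.pi / 4)]
        rw [integral_map (by fun_prop) hc.aestronglyMeasurable]
        simp_rw [gram_sub_gram_rotation]

end Decoupling

/-! ### The expected norm of the decoupled operator -/

section CrossGramNorm

variable {H : Type*} [NormedAddCommGroup H] [InnerProductSpace ℝ H] [CompleteSpace H]
  [SecondCountableTopology H] [MeasurableSpace H] [BorelSpace H] {I : Type*} [Fintype I]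
  {μ : Measure (I → H)} [IsGaussian μ]

/-- The Gaussian variable `z ↦ ⟪u, crossGram z z' u⟫ / 2`, with a sign `s`, as a linear form. -/
noncomputable def signedForm (z' : I → H) (s : ℝ) (u : H) : StrongDual ℝ (I → H) :=
  ∑ t, (s * ⟪z' t, u⟫) • (innerSL ℝ u).comp (ContinuousLinearMap.proj (R := ℝ) t)

lemma signedForm_apply (z' : I → H) (s : ℝ) (u : H) (z : I → H) :
    signedForm z' s u z = s * ∑ t, ⟪z' t, u⟫ * ⟪z t, u⟫ := by
  rw [signedForm, sum_apply, Finset.mul_sum]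
  refine Finset.sum_congr rfl fun t _ => ?_
  change (s * ⟪z' t, u⟫) * ⟪u, z t⟫ = _
  rw [real_inner_comm (z t) u]
  ring

lemma signedForm_sub_signedForm (z' : I → H) (s s' : ℝ) (u u' : H) (z : I → H) :
    signedForm z' s u z - signedForm z' s' u' z =
      ∑ t, ⟪z t, (s * ⟪z' t, u⟫) • u - (s' * ⟪z' t, u'⟫) • u'⟫ := by
  rw [signedForm_apply, signedForm_apply, Finset.mul_sum, Finset.mul_sum, ← Finset.sum_sub_distrib]
  refine Finset.sum_congr rfl fun t _ => ?_
  rw [inner_sub_right, real_inner_smul_right, real_inner_smul_right]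
  ring

lemma sum_inner_sq_le_norm_gram (z : I → H) {u : H} (hu : ‖u‖ ≤ 1) :
    ∑ t, ⟪z t, u⟫ ^ 2 ≤ ‖gram z‖ := by
  rw [← inner_gram_self]
  calc ⟪u, gram z u⟫ ≤ ‖u‖ * (‖gram z‖ * ‖u‖) :=
        (real_inner_le_norm _ _).trans (mul_le_mul_of_nonneg_left ((gram z).le_opNorm u)
          (norm_nonneg _))
    _ ≤ 1 * (‖gram z‖ * 1) := by gcongr
    _ = ‖gram z‖ := by ring

/-- The bound for `crossGram z z'` conditionally on `z'`: for fixed `z'` its quadratic form is a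
Gaussian family to which the Chevet-type inequality applies with `R ^ 2 = ‖gram z'‖`. -/
lemma integral_sup'_abs_inner_crossGram_le (hμ : μ[id] = 0) {Γ : H →L[ℝ] H}
    (hsym : ∀ u v, ⟪u, Γ v⟫ = ⟪v, Γ u⟫) (hpos : ∀ u, 0 ≤ ⟪u, Γ u⟫) {T : ℝ}
    (hT : ∀ (d : ℕ) (e : Fin d → H), Orthonormal ℝ e → ∑ k, ⟪e k, Γ (e k)⟫ ≤ T)
    (hdom : ∀ a : I → H, ∫ z, (∑ t, ⟪z t, a t⟫) ^ 2 ∂μ ≤ ∑ t, ⟪a t, Γ (a t)⟫)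
    {v : ℕ → H} (hv : ∀ k, ‖v k‖ ≤ 1) (N : ℕ) (z' : I → H) :
    ∫ z, Finset.univ.sup' Finset.univ_nonempty
        (fun j : Fin (N + 1) => |⟪v j, crossGram z z' (v j)⟫|) ∂μ ≤
      2 * √(‖gram z'‖ * T + ‖Γ‖ * ∑ t, ‖z' t‖ ^ 2
        + 2 * √‖gram z'‖ * ‖Γ‖ * √(∑ t, ‖z' t‖ ^ 2)) := by
  let s : Fin (N + 1) × Bool → ℝ := fun j => if j.2 then 1 else -1
  have h := integral_sup'_le_of_increments_le hμ Γ hsym hpos hT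
    (fun j : Fin (N + 1) × Bool => v j.1) (fun j => hv _) s
    (fun j => by simp only [s]; split_ifs <;> simp) z' (Real.sqrt_nonneg ‖gram z'‖)
    (fun j => by
      rw [Real.sq_sqrt (norm_nonneg _)]
      exact sum_inner_sq_le_norm_gram z' (hv _))
    (fun j => signedForm z' (s j) (v j.1))
    (fun j k => by
      simp only [signedForm_sub_signedForm]
      exact hdom _)
  rw [Real.sq_sqrt (norm_nonneg _)] at h
  refine le_trans ?_ (mul_le_mul_of_nonneg_left h zero_le_two)
  rw [← integral_const_mul]
  have hint : Integrable (fun z => Finset.univ.sup' Finset.univ_nonempty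
      (fun j => signedForm z' (s j) (v j.1) z)) μ := integrable_sup' μ _
  refine integral_mono_of_nonneg (.of_forall fun z => ?_) (hint.const_mul 2)
    (.of_forall fun z => ?_)
  · exact (abs_nonneg _).trans (Finset.le_sup'
      (fun j : Fin (N + 1) => |⟪v j, crossGram z z' (v j)⟫|) (Finset.mem_univ 0))
  · refine Finset.sup'_le _ _ fun j _ => ?_
    have hle : ∀ b, signedForm z' (s (j, b)) (v j) z ≤ Finset.univ.sup' Finset.univ_nonempty
        (fun j => signedForm z' (s j) (v j.1) z) := fun b =>
      Finset.le_sup' (fun j => signedForm z' (s j) (v j.1) z) (Finset.mem_univ (j, b))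
    have h1 := hle true
    have h2 := hle false
    simp only [s, signedForm_apply, if_true, Bool.false_eq_true, if_false] at h1 h2 ⊢
    rw [inner_crossGram_self, abs_le]
    constructor <;> linarith

/-- The conditional bound is integrated over `z` by the Jensen and Cauchy–Schwarz inequalities. -/
lemma integral_sqrt_bound_le {T B : ℝ} (hT : 0 ≤ T) (hB : 0 ≤ B) :
    Integrable (fun z : I → H => √(‖gram z‖ * T + B * ∑ t, ‖z t‖ ^ 2
        + 2 * √‖gram z‖ * B * √(∑ t, ‖z t‖ ^ 2))) μ ∧
    ∫ z : I → H, √(‖gram z‖ * T + B * ∑ t, ‖z t‖ ^ 2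
        + 2 * √‖gram z‖ * B * √(∑ t, ‖z t‖ ^ 2)) ∂μ ≤
      √((∫ z, ‖gram z‖ ∂μ) * T + B * (∫ z, ∑ t, ‖z t‖ ^ 2 ∂μ)
        + 2 * B * (√(∫ z, ‖gram z‖ ∂μ) * √(∫ z, ∑ t, ‖z t‖ ^ 2 ∂μ))) := by
  have hG : Integrable (fun z : I → H => ‖gram z‖) μ := integrable_gram.norm
  have hQ : Integrable (fun z : I → H => ∑ t, ‖z t‖ ^ 2) μ := integrable_sum_norm_sq
  have hQ0 : ∀ z : I → H, 0 ≤ ∑ t, ‖z t‖ ^ 2 := fun z => Finset.sum_nonneg fun t _ => sq_nonneg _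
  have hS : Integrable (fun z : I → H => √‖gram z‖ * √(∑ t, ‖z t‖ ^ 2)) μ := by
    refine hQ.mono' ((Real.continuous_sqrt.comp_aestronglyMeasurable hG.aestronglyMeasurable).mul
      (Real.continuous_sqrt.comp_aestronglyMeasurable hQ.aestronglyMeasurable))
      (.of_forall fun z => ?_)
    rw [Real.norm_of_nonneg (by positivity)]
    calc √‖gram z‖ * √(∑ t, ‖z t‖ ^ 2) ≤ √(∑ t, ‖z t‖ ^ 2) * √(∑ t, ‖z t‖ ^ 2) := by
          gcongr
          exact norm_gram_le z
      _ = _ := Real.mul_self_sqrt (hQ0 z)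
  have e : ∀ z : I → H, ‖gram z‖ * T + B * ∑ t, ‖z t‖ ^ 2
      + 2 * √‖gram z‖ * B * √(∑ t, ‖z t‖ ^ 2) = ‖gram z‖ * T + B * ∑ t, ‖z t‖ ^ 2
      + 2 * B * (√‖gram z‖ * √(∑ t, ‖z t‖ ^ 2)) := fun z => by ring
  simp only [e]
  have h0 : ∀ z : I → H, 0 ≤ ‖gram z‖ * T + B * ∑ t, ‖z t‖ ^ 2
      + 2 * B * (√‖gram z‖ * √(∑ t, ‖z t‖ ^ 2)) := fun z => by
    have := hQ0 z
    positivity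
  have hF : Integrable (fun z : I → H => ‖gram z‖ * T + B * ∑ t, ‖z t‖ ^ 2
      + 2 * B * (√‖gram z‖ * √(∑ t, ‖z t‖ ^ 2))) μ :=
    ((hG.mul_const T).add (hQ.const_mul B)).add (hS.const_mul (2 * B))
  have hm : MemLp (fun z : I → H => √(‖gram z‖ * T + B * ∑ t, ‖z t‖ ^ 2
      + 2 * B * (√‖gram z‖ * √(∑ t, ‖z t‖ ^ 2)))) 2 μ := by
    rw [memLp_two_iff_integrable_sq
      (Real.continuous_sqrt.comp_aestronglyMeasurable hF.aestronglyMeasurable)]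
    simpa only [Real.sq_sqrt (h0 _)] using hF
  refine ⟨hm.integrable (by norm_num),
    (integral_le_sqrt_integral_sq hm).trans (Real.sqrt_le_sqrt ?_)⟩
  simp only [Real.sq_sqrt (h0 _)]
  have hGQ : Integrable (fun z : I → H => ‖gram z‖ * T + B * ∑ t, ‖z t‖ ^ 2) μ :=
    (hG.mul_const T).add (hQ.const_mul B)
  rw [integral_add hGQ (hS.const_mul (2 * B)),
    integral_add (hG.mul_const T) (hQ.const_mul B), integral_mul_const, integral_const_mul,
    integral_const_mul]
  gcongr
  exact integral_sqrt_mul_sqrt_le (fun z => norm_nonneg _) hQ0 hG hQ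

/-- The conditional bound, integrated over `z'`. The maxima over finitely many vectors of a dense
sequence pass to the operator norm by dominated convergence. -/
lemma integral_norm_crossGram_le (hμ : μ[id] = 0) {Γ : H →L[ℝ] H}
    (hsym : ∀ u v, ⟪u, Γ v⟫ = ⟪v, Γ u⟫) (hpos : ∀ u, 0 ≤ ⟪u, Γ u⟫) {T : ℝ}
    (hT : ∀ (d : ℕ) (e : Fin d → H), Orthonormal ℝ e → ∑ k, ⟪e k, Γ (e k)⟫ ≤ T)
    (hdom : ∀ a : I → H, ∫ z, (∑ t, ⟪z t, a t⟫) ^ 2 ∂μ ≤ ∑ t, ⟪a t, Γ (a t)⟫) :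
    ∫ p, ‖crossGram p.1 p.2‖ ∂(μ.prod μ) ≤
      2 * √((∫ z, ‖gram z‖ ∂μ) * T + ‖Γ‖ * (∫ z, ∑ t, ‖z t‖ ^ 2 ∂μ)
        + 2 * ‖Γ‖ * (√(∫ z, ‖gram z‖ ∂μ) * √(∫ z, ∑ t, ‖z t‖ ^ 2 ∂μ))) := by
  obtain ⟨v, hv1, hv⟩ := exists_dense_seq_unit_ball (H := H)
  have hT0 : 0 ≤ T := by
    have := hT 0 Fin.elim0 (orthonormal_subsingleton_iff.2 fun i => i.elim0)
    simpa using this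
  let F : ℕ → (I → H) × (I → H) → ℝ := fun N p => Finset.univ.sup' Finset.univ_nonempty
    (fun j : Fin (N + 1) => |⟪v j, crossGram p.1 p.2 (v j)⟫|)
  have hFc : ∀ N, Continuous (F N) := fun N => by
    have h : Continuous fun (p : (I → H) × (I → H)) (j : Fin (N + 1)) =>
        |⟪v j, crossGram p.1 p.2 (v j)⟫| := by
      have := continuous_crossGram (H := H) (I := I)
      fun_prop
    exact continuous_sup'.comp h
  have hF0 : ∀ N p, 0 ≤ F N p := fun N p => (abs_nonneg _).trans (Finset.le_sup'
      (fun j : Fin (N + 1) => |⟪v j, crossGram p.1 p.2 (v j)⟫|) (Finset.mem_univ 0))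
  have hlim : ∀ p, Filter.Tendsto (fun N => F N p) Filter.atTop (nhds ‖crossGram p.1 p.2‖) :=
    fun p => tendsto_sup'_abs_inner (inner_crossGram_comm p.1 p.2) hv1 hv
  have hFle : ∀ N p, F N p ≤ ‖crossGram p.1 p.2‖ := fun N p => by
    refine Finset.sup'_le _ _ fun j _ => (abs_real_inner_le_norm _ _).trans ?_
    calc ‖v j‖ * ‖crossGram p.1 p.2 (v j)‖ ≤ 1 * (‖crossGram p.1 p.2‖ * 1) :=
          mul_le_mul (hv1 _) ((ContinuousLinearMap.le_opNorm _ _).trans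
            (mul_le_mul_of_nonneg_left (hv1 _) (norm_nonneg _))) (norm_nonneg _) zero_le_one
      _ = _ := by ring
  have hbound : ∀ N, ∀ᵐ p ∂(μ.prod μ), ‖F N p‖ ≤ ‖crossGram p.1 p.2‖ := fun N =>
    .of_forall fun p => by rw [Real.norm_of_nonneg (hF0 N p)]; exact hFle N p
  have hni : Integrable (fun p : (I → H) × (I → H) => ‖crossGram p.1 p.2‖) (μ.prod μ) :=
    integrable_crossGram.norm
  refine le_of_tendsto' (tendsto_integral_of_dominated_convergence _
    (fun N => (hFc N).aestronglyMeasurable) hni hbound (.of_forall hlim)) fun N => ?_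
  have hFi : Integrable (F N) (μ.prod μ) :=
    hni.mono' (hFc N).aestronglyMeasurable (hbound N)
  rw [integral_prod_symm _ hFi]
  obtain ⟨hi, hle⟩ := integral_sqrt_bound_le (μ := μ) hT0 (norm_nonneg Γ)
  refine le_trans ?_ (mul_le_mul_of_nonneg_left hle zero_le_two)
  rw [← integral_const_mul]
  exact integral_mono_of_nonneg (.of_forall fun z' => integral_nonneg fun z => hF0 N (z, z'))
    (hi.const_mul 2) (.of_forall fun z' =>
      integral_sup'_abs_inner_crossGram_le hμ hsym hpos hT hdom hv1 N z')

end CrossGramNorm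

/-! ### Solving the self-bounding inequality -/

/-- The normalized form of the self-bounding inequality. The two bounds on `β` are used in the
complementary ranges `1 ≤ 2 * r ^ 2` and `2 * r ^ 2 ≤ 1`. -/
lemma le_of_sq_le_normalized {A r q y β : ℝ} (hr : 0 ≤ r) (hq : 0 ≤ q) (hy : 0 ≤ y)
    (hβ1 : β ≤ 1) (hβr : β ^ 2 ≤ 2 * r ^ 2) (hyA : y ^ 2 = r ^ 2 + A)
    (h : A ^ 2 ≤ 4 * (y ^ 2 + q ^ 2 + 2 * β * (y * q))) :
    A ≤ 4 + 4 * r + 2 * √2 * q := by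
  have hc0 : 0 ≤ √2 := Real.sqrt_nonneg 2
  have hc2 : √2 * √2 = 2 := Real.mul_self_sqrt (by norm_num)
  have hc1 : 1 ≤ √2 := by nlinarith
  have hc3 : √2 ≤ 3 / 2 := by nlinarith
  have hyq : 0 ≤ y * q := mul_nonneg hy hq
  set c := √2
  rcases le_total 1 (c * r) with hcr | hcr
  · have h1 : A ≤ 2 * (y + q) := by
      refine abs_le_of_sq_le_sq' ?_ (by positivity) |>.2
      nlinarith [mul_le_mul_of_nonneg_right hβ1 hyq]
    have h2 : y ≤ 2 + 2 * r + (c - 1) * q := by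
      have hn : 0 ≤ 1 + 2 * r + (c - 1) * q := by
        have := mul_nonneg (sub_nonneg.2 hc1) hq
        positivity
      have h3 : (y - 1) ^ 2 ≤ (1 + 2 * r + (c - 1) * q) ^ 2 := by
        have h4 : 0 ≤ (c * r - 1) * ((c - 1) * q) :=
          mul_nonneg (sub_nonneg.2 hcr) (mul_nonneg (sub_nonneg.2 hc1) hq)
        have h5 : (c * r) * ((c - 1) * q) = 2 * r * q - c * r * q := by linear_combination r * q * hc2
        -- twice `c` times `h4` turns the mixed term `r * q` into a multiple of `q`
        have h6 := mul_nonneg hc0 h4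
        have h7 : c * ((c * r - 1) * ((c - 1) * q)) = 2 * ((c - 1) * (r * q)) - (2 - c) * q := by
          linear_combination ((c - 1) * r * q - q) * hc2
        nlinarith [sq_nonneg ((c - 1) * q), sq_nonneg r]
      linarith [(abs_le_of_sq_le_sq' h3 hn).2]
    linarith
  · have hβ' : β ≤ c * r := by
      refine (abs_le_of_sq_le_sq' ?_ (by positivity)).2
      nlinarith
    by_contra! hA
    -- the tangent of the square root at `9`
    have hy' : y ≤ (r ^ 2 + A) / 6 + 3 / 2 := by nlinarith [sq_nonneg (y - 3)]
    have h1 : β * (y * q) ≤ c * r * (((r ^ 2 + A) / 6 + 3 / 2) * q) := by gcongr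
    have hrq : c * r * q ≤ q := mul_le_of_le_one_left hq hcr
    have h2 : 0 ≤ A - (4 + 4 / 3 * (c * r * q)) := by nlinarith
    have h3 : (4 + 4 * r + 2 * c * q) * ((4 + 4 * r + 2 * c * q) - (4 + 4 / 3 * (c * r * q)))
        < A * (A - (4 + 4 / 3 * (c * r * q))) := by
      have h5 : 0 < A + (4 * r + 2 * c * q - 4 / 3 * (c * r * q)) := by nlinarith
      nlinarith [mul_pos (sub_pos.2 hA) h5]
    have h4 : 4 * r ^ 2 + 4 * q ^ 2 + 8 * (c * r * ((r ^ 2 / 6 + 3 / 2) * q)) ≤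
        (4 + 4 * r + 2 * c * q) * ((4 + 4 * r + 2 * c * q) - (4 + 4 / 3 * (c * r * q))) := by
      have hr34 : r ≤ 3 / 4 := by nlinarith
      have e1 : r * q ^ 2 ≤ 3 / 4 * q ^ 2 := by gcongr
      have e2 : r * q ≤ 3 / 4 * q := by gcongr
      have e3 : r * (c * r * q) ≤ r * q := by gcongr
      have e4 : r * (r * (c * r * q)) ≤ 3 / 4 * (r * q) := by gcongr
      have e5 : q ≤ c * q := le_mul_of_one_le_left hq hc1
      have e6 : (2 * c * q) * (4 / 3 * (c * r * q)) = 16 / 3 * (r * q ^ 2) := by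
        linear_combination 8 / 3 * r * q ^ 2 * hc2
      have e7 : (2 * c * q) * (2 * c * q) = 8 * q ^ 2 := by linear_combination 4 * q ^ 2 * hc2
      have e8 : (4 + 4 * r + 2 * c * q) * ((4 + 4 * r + 2 * c * q) - (4 + 4 / 3 * (c * r * q)))
          - (4 * r ^ 2 + 4 * q ^ 2 + 8 * (c * r * ((r ^ 2 / 6 + 3 / 2) * q)))
          = 16 * r + 12 * r ^ 2 + (2 * c * q) * (2 * c * q) - 4 * q ^ 2 + 8 * (c * q)
            - 4 / 3 * (c * r * q) - 16 / 3 * (r * (c * r * q)) - 4 / 3 * (r * (r * (c * r * q)))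
            - (2 * c * q) * (4 / 3 * (c * r * q)) := by ring
      have e9 : 0 ≤ r ^ 2 := sq_nonneg r
      linarith
    nlinarith

/-- Solving the self-bounding inequality for the deviation `A`, where `Y ≤ N + A` is the expected
norm of the random operator and `N` the norm of its mean. -/
theorem le_of_le_two_mul_sqrt {A Y N T B Q : ℝ} (hA : 0 ≤ A) (hN : 0 ≤ N) (hT : 0 ≤ T)
    (hB : 0 ≤ B) (hQ : 0 ≤ Q) (hBT : B ≤ T) (hBN : B ≤ 2 * N) (hY : Y ≤ N + A)
    (h : A ≤ 2 * √(Y * T + B * Q + 2 * B * (√Y * √Q))) :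
    A ≤ 4 * T + 4 * √(N * T) + 2 * √2 * √(Q * B) := by
  rcases hT.eq_or_lt with rfl | hT
  · obtain rfl : B = 0 := le_antisymm hBT hB
    simpa using h
  have hτ : 0 < √T := Real.sqrt_pos.2 hT
  have hτ2 : √T ^ 2 = T := Real.sq_sqrt hT.le
  have h2 : A ≤ 2 * √((N + A) * T + B * Q + 2 * B * (√(N + A) * √Q)) := by
    refine h.trans ?_
    gcongr
  have hsq : A ^ 2 ≤ 4 * ((N + A) * T + B * Q + 2 * B * (√(N + A) * √Q)) := by
    have h0 : 0 ≤ (N + A) * T + B * Q + 2 * B * (√(N + A) * √Q) := by positivity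
    calc A ^ 2 ≤ (2 * √((N + A) * T + B * Q + 2 * B * (√(N + A) * √Q))) ^ 2 := by gcongr
      _ = _ := by rw [mul_pow, Real.sq_sqrt h0]; norm_num
  have key := le_of_sq_le_normalized (A := A / T) (r := √N / √T) (q := √B * √Q / T)
    (y := √(N + A) / √T) (β := √B / √T) (by positivity) (by positivity) (by positivity)
    ((div_le_one hτ).2 (Real.sqrt_le_sqrt hBT))
    (by
      rw [div_pow, div_pow, Real.sq_sqrt hB, Real.sq_sqrt hN, ← mul_div_assoc]
      gcongr)
    (by
      rw [div_pow, div_pow, Real.sq_sqrt hN, Real.sq_sqrt (by positivity), hτ2, add_div])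
    (by
      have e : 4 * ((√(N + A) / √T) ^ 2 + (√B * √Q / T) ^ 2
          + 2 * (√B / √T) * (√(N + A) / √T * (√B * √Q / T)))
          = 4 * ((N + A) * T + B * Q + 2 * B * (√(N + A) * √Q)) / T ^ 2 := by
        have e1 : √B / √T * (√(N + A) / √T * (√B * √Q / T))
            = B * (√(N + A) * √Q) / T ^ 2 := by
          rw [show √B / √T * (√(N + A) / √T * (√B * √Q / T))
            = √B ^ 2 * (√(N + A) * √Q) / (√T ^ 2 * T) by field_simp, hτ2, Real.sq_sqrt hB, pow_two]
        rw [mul_assoc 2, e1, div_pow, div_pow, mul_pow, Real.sq_sqrt (by positivity), hτ2,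
          Real.sq_sqrt hB, Real.sq_sqrt hQ]
        field_simp
      rw [e, div_pow]
      gcongr)
  rw [div_le_iff₀ hT] at key
  refine key.trans_eq ?_
  rw [Real.sqrt_mul hN, mul_comm Q B, Real.sqrt_mul hB]
  have e : √N / √T * T = √N * √T := by
    rw [div_mul_eq_mul_div, div_eq_iff hτ.ne', mul_assoc, ← pow_two, hτ2]
  rw [add_mul, add_mul, mul_assoc 4, e]
  field_simp

/-! ### The empirical covariance operator -/

section SampleGram

variable {H : Type*} [NormedAddCommGroup H] [InnerProductSpace ℝ H] [CompleteSpace H]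
  [SecondCountableTopology H] [MeasurableSpace H] [BorelSpace H]

/-- The deviation bound for a centered Gaussian vector in `I → H` whose covariance is dominated by
that of `card I` independent vectors with covariance `Γ`. -/
theorem integral_norm_gram_sub_le_of_dominated {I : Type*} [Fintype I] {μ : Measure (I → H)}
    [IsGaussian μ] (hμ : μ[id] = 0) {Γ : H →L[ℝ] H}
    (hsym : ∀ u v, ⟪u, Γ v⟫ = ⟪v, Γ u⟫) (hpos : ∀ u, 0 ≤ ⟪u, Γ u⟫) {T N : ℝ}
    (hT : ∀ (d : ℕ) (e : Fin d → H), Orthonormal ℝ e → ∑ k, ⟪e k, Γ (e k)⟫ ≤ T)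
    (hdom : ∀ a : I → H, ∫ z, (∑ t, ⟪z t, a t⟫) ^ 2 ∂μ ≤ ∑ t, ⟪a t, Γ (a t)⟫)
    (hN : ‖∫ z, gram z ∂μ‖ ≤ N) (hΓT : ‖Γ‖ ≤ T) (hΓN : ‖Γ‖ ≤ 2 * N) :
    ∫ z, ‖gram z - ∫ z', gram z' ∂μ‖ ∂μ ≤
      4 * T + 4 * √(N * T) + 2 * √2 * √((∫ z, ∑ t, ‖z t‖ ^ 2 ∂μ) * ‖Γ‖) := by
  have hi : Integrable (gram : (I → H) → H →L[ℝ] H) μ := integrable_gram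
  have hd : Integrable (fun z => gram z - ∫ z', gram z' ∂μ) μ := hi.sub (integrable_const _)
  refine le_of_le_two_mul_sqrt (Y := ∫ z, ‖gram z‖ ∂μ) (integral_nonneg fun _ => norm_nonneg _)
    ((norm_nonneg _).trans hN) ((norm_nonneg _).trans hΓT) (norm_nonneg _)
    (integral_nonneg fun _ => Finset.sum_nonneg fun _ _ => sq_nonneg _) hΓT hΓN ?_
    ((integral_norm_gram_sub_le hμ).trans (integral_norm_crossGram_le hμ hsym hpos hT hdom))
  calc ∫ z, ‖gram z‖ ∂μ ≤ ∫ z, (N + ‖gram z - ∫ z', gram z' ∂μ‖) ∂μ := by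
        refine integral_mono hi.norm ((integrable_const _).add hd.norm) fun z => ?_
        have := norm_add_le (∫ z', gram z' ∂μ) (gram z - ∫ z', gram z' ∂μ)
        rw [add_sub_cancel] at this
        exact this.trans (add_le_add_left hN _)
    _ = _ := by rw [integral_add (integrable_const _) hd.norm]; simp

variable {Ω : Type*} [MeasurableSpace Ω] {P : Measure Ω} [IsProbabilityMeasure P]
  {x : ℤ → Ω → H} {n : ℕ}

lemma empCov_eq_smul_gram (ω : Ω) :
    empCov x n ω = (1 / (n : ℝ)) • gram (fun t : Finset.Icc (1 : ℤ) n => x t ω) := by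
  rw [empCov, gram, Finset.sum_coe_sort (Finset.Icc (1 : ℤ) n)
    (fun t => InnerProductSpace.rankOne ℝ (x t ω) (x t ω))]

lemma integral_gram_eq (hs : IsStationary P x) (hx : ∀ t, MemLp (x t) 2 P) :
    ∫ ω, gram (fun t : Finset.Icc (1 : ℤ) n => x t ω) ∂P = (n : ℝ) • crossCov P x 0 := by
  simp only [gram]
  rw [integral_finsetSum _ fun (t : Finset.Icc (1 : ℤ) n) _ => integrable_rankOne hx t t]
  simp only [integral_rankOne_eq_crossCov hs hx]
  simp [← Nat.cast_smul_eq_nsmul ℝ]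

lemma norm_empCov_sub (hn : 1 ≤ n) (ω : Ω) (C : H →L[ℝ] H) :
    ‖empCov x n ω - C‖ =
      (1 / (n : ℝ)) * ‖gram (fun t : Finset.Icc (1 : ℤ) n => x t ω) - (n : ℝ) • C‖ := by
  have hn0 : (n : ℝ) ≠ 0 := by positivity
  have e : empCov x n ω - C =
      (1 / (n : ℝ)) • (gram (fun t : Finset.Icc (1 : ℤ) n => x t ω) - (n : ℝ) • C) := by
    rw [empCov_eq_smul_gram, smul_sub, smul_smul, one_div_mul_cancel hn0, one_smul]
  rw [e, norm_smul, Real.norm_of_nonneg (by positivity)]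

/-- The deviation bound with the traces of the lag-zero covariance operator and of the integrated
covariance operator replaced by the mean of `‖x 0‖ ^ 2` and by `integratedTrace`. -/
theorem integral_norm_empCov_sub_le (hgauss : IsGaussianProcess x P)
    (hcent : ∀ t, ∫ ω, x t ω ∂P = 0) (hs : IsStationary P x) (hx : ∀ t, MemLp (x t) 2 P)
    (hn : 1 ≤ n) {ι : ℕ → Type*} {σ : ∀ h, ι h → ℝ} {f g : ∀ h, ι h → H}
    (hsvd : ∀ h ∈ Finset.Ico 1 n, IsSVD (crossCov P x (h : ℤ)) (σ h) (f h) (g h)) :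
    Integrable (fun ω => ‖empCov x n ω - crossCov P x 0‖) P ∧
    ∫ ω, ‖empCov x n ω - crossCov P x 0‖ ∂P ≤
      (2 * √2 / n) *
        (√2 * integratedTrace P x σ n
          + √(2 * n * ‖crossCov P x 0‖ * integratedTrace P x σ n)
          + √(n * (∫ ω, ‖x 0 ω‖ ^ 2 ∂P) * ‖integratedCov P x σ f g n‖)) := by
  have hn0 : (0 : ℝ) < n := by positivity
  let X : Ω → (Finset.Icc (1 : ℤ) n → H) := fun ω t => x t ω
  have hX : HasGaussianLaw X P := hgauss.hasGaussianLaw (Finset.Icc (1 : ℤ) n)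
  have hXm : AEMeasurable X P := hX.aemeasurable
  have : IsGaussian (P.map X) := hX.isGaussian_map
  have hμ : (P.map X)[id] = 0 := by
    funext t
    have h := (ContinuousLinearMap.proj (R := ℝ) (φ := fun _ : Finset.Icc (1 : ℤ) n => H)
      t).integral_comp_comm (IsGaussian.integrable_id (μ := P.map X))
    refine h.symm.trans ?_
    change ∫ z : Finset.Icc (1 : ℤ) n → H, z t ∂(P.map X) = 0
    rw [integral_map hXm (continuous_apply t).aestronglyMeasurable]
    exact hcent t
  have hmean : ∫ z, gram z ∂(P.map X) = (n : ℝ) • crossCov P x 0 := by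
    rw [integral_map hXm continuous_gram.stronglyMeasurable.aestronglyMeasurable]
    exact integral_gram_eq hs hx
  have hsq : ∫ z : Finset.Icc (1 : ℤ) n → H, ∑ t, ‖z t‖ ^ 2 ∂(P.map X)
      = n * ∫ ω, ‖x 0 ω‖ ^ 2 ∂P := by
    have hc : Continuous fun z : Finset.Icc (1 : ℤ) n → H => ∑ t, ‖z t‖ ^ 2 :=
      continuous_finsetSum _ fun t _ => by fun_prop
    rw [integral_map hXm hc.aestronglyMeasurable,
      integral_finsetSum _ fun (t : Finset.Icc (1 : ℤ) n) _ => (hx t).norm.integrable_sq]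
    simp only [integral_norm_sq_eq hs hx]
    simp
  have hdom : ∀ a : Finset.Icc (1 : ℤ) n → H, ∫ z, (∑ t, ⟪z t, a t⟫) ^ 2 ∂(P.map X) ≤
      ∑ t, ⟪a t, integratedCov P x σ f g n (a t)⟫ := fun a => by
    classical
    have hc : Continuous fun z : Finset.Icc (1 : ℤ) n → H => (∑ t, ⟪z t, a t⟫) ^ 2 :=
      (continuous_finsetSum _ fun t _ => by fun_prop).pow 2
    rw [integral_map hXm hc.aestronglyMeasurable]
    let a' : ℤ → H := fun t => if h : t ∈ Finset.Icc (1 : ℤ) n then a ⟨t, h⟩ else 0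
    have ha : ∀ t : Finset.Icc (1 : ℤ) n, a' t = a t := fun t => dif_pos t.2
    have h := integral_sum_inner_sq_le hs hx hsvd a'
    simp_rw [← Finset.sum_coe_sort (Finset.Icc (1 : ℤ) n), ha] at h
    exact h
  have hgi : Integrable (fun ω => gram (X ω)) P :=
    (integrable_gram (μ := P.map X)).comp_aemeasurable hXm
  have hmain := integral_norm_gram_sub_le_of_dominated hμ (inner_integratedCov_comm hx hsvd)
    (inner_integratedCov_self_nonneg hx hsvd) (N := n * ‖crossCov P x 0‖)
    (fun d e he => sum_inner_integratedCov_le hx hsvd he) hdom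
    (by rw [hmean, norm_smul, Real.norm_of_nonneg hn0.le])
    (norm_integratedCov_le_trace hx hsvd)
    ((norm_integratedCov_le hs hx hn hsvd).trans_eq (by ring))
  have hc : Continuous fun z : Finset.Icc (1 : ℤ) n → H =>
      ‖gram z - (n : ℝ) • crossCov P x 0‖ := (continuous_gram.sub continuous_const).norm
  rw [hmean, hsq, integral_map hXm hc.aestronglyMeasurable] at hmain
  simp_rw [norm_empCov_sub hn]
  refine ⟨(hgi.sub (integrable_const _)).norm.const_mul _, ?_⟩
  rw [integral_const_mul]
  have e2 : √2 * √2 = 2 := Real.mul_self_sqrt zero_le_two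
  have e3 : √(2 * n * ‖crossCov P x 0‖ * integratedTrace P x σ n)
      = √2 * √(n * ‖crossCov P x 0‖ * integratedTrace P x σ n) := by
    rw [← Real.sqrt_mul zero_le_two]
    congr 1
    ring
  calc _ ≤ 1 / (n : ℝ) * _ := mul_le_mul_of_nonneg_left hmain (by positivity)
    _ = _ := by
      rw [e3]
      -- hiding the square root keeps `field_simp` from rearranging its argument
      generalize √(n * ‖crossCov P x 0‖ * integratedTrace P x σ n) = r
      field_simp
      linear_combination (-2 * integratedTrace P x σ n
        - 2 * r) * e2

end SampleGram

end DependentCovariance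

theorem mainTheorem5
    {H : Type*} [NormedAddCommGroup H] [InnerProductSpace ℝ H] [CompleteSpace H]
    [TopologicalSpace.SeparableSpace H] [MeasurableSpace H] [BorelSpace H]
    {Ω : Type*} [MeasurableSpace Ω] (P : Measure Ω) [IsProbabilityMeasure P]
    (x : ℤ → Ω → H)
    (hgauss : IsGaussianProcess x P)
    (hcent : ∀ t, ∫ ω, x t ω ∂P = 0)
    (hstat : DependentCovariance.IsStationary P x)
    (htc : ∀ h : ℤ, DependentCovariance.IsTraceClass (DependentCovariance.crossCov P x h))
    (n : ℕ) (hn : 1 ≤ n)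
    -- an arbitrary singular value decomposition of each lag-`h` cross-covariance operator
    {ι : ℕ → Type*} (σ : ∀ h, ι h → ℝ) (f g : ∀ h, ι h → H)
    (hsvd : ∀ h ∈ Finset.Ico 1 n,
      DependentCovariance.IsSVD (DependentCovariance.crossCov P x (h : ℤ)) (σ h) (f h) (g h))
    -- an arbitrary Hilbert basis, along which traces are computed
    {κ : Type*} (b : HilbertBasis κ ℝ H) :
    let cov : H →L[ℝ] H := DependentCovariance.crossCov P x 0
    let bar : H →L[ℝ] H := DependentCovariance.integratedCov P x σ f g n
    Integrable (fun ω => ‖DependentCovariance.empCov x n ω - cov‖) P ∧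
    Summable (fun i => ⟪b i, cov (b i)⟫) ∧
    Summable (fun i => ⟪b i, bar (b i)⟫) ∧
    ∫ ω, ‖DependentCovariance.empCov x n ω - cov‖ ∂P ≤
      (2 * √2 / n) *
        (√2 * DependentCovariance.trace b bar
          + √(2 * n * ‖cov‖ * DependentCovariance.trace b bar)
          + √(n * DependentCovariance.trace b cov * ‖bar‖)) := by
  intro cov bar
  have : SecondCountableTopology H := UniformSpace.secondCountable_of_separable H
  have hx : ∀ t, MemLp (x t) 2 P := fun t => (hgauss.hasGaussianLaw_eval t).memLp_two
  have hcov := DependentCovariance.hasSum_trace_crossCov_zero hx b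
  have hbar := DependentCovariance.hasSum_trace_integratedCov hx hsvd b
  obtain ⟨hi, hle⟩ := DependentCovariance.integral_norm_empCov_sub_le hgauss hcent hstat hx hn hsvd
  refine ⟨hi, hcov.summable, hbar.summable, ?_⟩
  rwa [show DependentCovariance.trace b bar = _ from hbar.tsum_eq,
    show DependentCovariance.trace b cov = _ from hcov.tsum_eq]
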